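/- Let $k$ be an infinite field and let $\Gamma$ be an ordered abelian group of rank $1$ (that is, $\Gamma \neq 0$ and its only convex subgroups are $0$ and $\Gamma$). Let $K = k(\!(t^{\Gamma})\!)$ be the field of Hahn series $\sum_{q\in\Gamma} c_q t^q$ with coefficients $c_q \in k$ and well-ordered support, with valuation $v\colon K\to \Gamma\cup\{\infty\}$, $v(x)=\min \operatorname{supp}(x)$ for $x \neq 0$, and total residue map $$\operatorname{res}\colon K\to k,\qquad \sum_{q\in\Gamma} c_q t^q\mapsto c_0 .$$ Let $L_{\operatorname{res}}$ be the three-sorted first-order language with sorts for the field $K$, for $\Gamma\cup\{\infty\}$ and for the residue field $k$, with the language of rings on $K$ and on $k$, the symbols $0,\infty,+,<$ on $\Gamma\cup\{\infty\}$, and function symbols for $v\colon K\to\Gamma\cup\{\infty\}$ and $\operatorname{res}\colon K\to k$; it contains no constant symbol for $t$. Then the $L_{\operatorname{res}}$-structure $(K,\Gamma\cup\{\infty\},k;v,\operatorname{res})$ interprets $(\mathbb{N},+,\cdot)$ without parameters, and it is undecidable: there is no algorithm that decides, given an $L_{\operatorname{res}}$-sentence, whether it is true in this structure. The same two assertions hold,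 for every infinite field $k$, for the Puiseux series field $k\{\!\{t\}\!\}=\bigcup_{n\geq 1} k(\!(t^{1/n})\!)$, with value group $\mathbb{Q}$, residue field $k$, and the valuation $v$ and the total residue map $\operatorname{res}$ given by the same formulas. -/

import Mathlib

universe u v

/-- An ordered abelian group has rank one if it is non-trivial and its only convex subgroups
are `0` and the whole group. -/
def IsRankOne (Γ : Type v) [AddCommGroup Γ] [LinearOrder Γ] : Prop :=
  Nontrivial Γ ∧ ∀ H : AddSubgroup Γ, (H : Set Γ).OrdConnected → H = ⊥ ∨ H = ⊤

namespace LRes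

/-! ### Syntax of the three-sorted language `L_res`

The sorts are the valued field `K`, the value group with infinity `V = Γ ∪ {∞}` and the residue
field `k`. Both fields carry the language of rings, `V` carries `0, ∞, +, <`, and there are
function symbols `v : K → V` and `res : K → k`. Each sort has variables named by the natural
numbers. There is no constant for `t`. -/

/-- Terms of the field sort. -/
inductive TermK : Type
  | var : ℕ → TermK
  | zero : TermK
  | one : TermK
  | neg : TermK → TermK
  | add : TermK → TermK → TermK
  | mul : TermK → TermK → TermK

/-- Terms of the value group sort. -/
inductive TermV : Type
  | var : ℕ → TermV
  | zero : TermV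
  | infty : TermV
  | add : TermV → TermV → TermV
  | val : TermK → TermV

/-- Terms of the residue field sort. -/
inductive TermR : Type
  | var : ℕ → TermR
  | zero : TermR
  | one : TermR
  | neg : TermR → TermR
  | add : TermR → TermR → TermR
  | mul : TermR → TermR → TermR
  | res : TermK → TermR

/-- First-order formulas of `L_res`, with one existential quantifier for each sort. -/
inductive Formula : Type
  | eqK : TermK → TermK → Formula
  | eqV : TermV → TermV → Formula
  | eqR : TermR → TermR → Formula
  | ltV : TermV → TermV → Formula
  | not : Formula → Formula
  | and : Formula → Formula → Formula
  | exK : ℕ → Formula → Formula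
  | exV : ℕ → Formula → Formula
  | exR : ℕ → Formula → Formula

/-- The three sorts. -/
inductive Srt : Type
  | K
  | V
  | R

/-! ### Free variables -/

def TermK.vars : TermK → Set (Srt × ℕ)
  | .var n => {(.K, n)}
  | .zero => ∅
  | .one => ∅
  | .neg s => s.vars
  | .add s t => s.vars ∪ t.vars
  | .mul s t => s.vars ∪ t.vars

def TermV.vars : TermV → Set (Srt × ℕ)
  | .var n => {(.V, n)}
  | .zero => ∅
  | .infty => ∅
  | .add s t => s.vars ∪ t.vars
  | .val s => s.vars

def TermR.vars : TermR → Set (Srt × ℕ)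
  | .var n => {(.R, n)}
  | .zero => ∅
  | .one => ∅
  | .neg s => s.vars
  | .add s t => s.vars ∪ t.vars
  | .mul s t => s.vars ∪ t.vars
  | .res s => s.vars

def Formula.freeVars : Formula → Set (Srt × ℕ)
  | .eqK s t => s.vars ∪ t.vars
  | .eqV s t => s.vars ∪ t.vars
  | .eqR s t => s.vars ∪ t.vars
  | .ltV s t => s.vars ∪ t.vars
  | .not φ => φ.freeVars
  | .and φ ψ => φ.freeVars ∪ ψ.freeVars
  | .exK n φ => φ.freeVars \ {(.K, n)}
  | .exV n φ => φ.freeVars \ {(.V, n)}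
  | .exR n φ => φ.freeVars \ {(.R, n)}

/-- A sentence is a formula without free variables. -/
def Formula.IsSentence (φ : Formula) : Prop := φ.freeVars = ∅

/-! ### Gödel numbering -/

def TermK.code : TermK → ℕ
  | .var n => Nat.pair 0 n
  | .zero => Nat.pair 1 0
  | .one => Nat.pair 2 0
  | .neg s => Nat.pair 3 s.code
  | .add s t => Nat.pair 4 (Nat.pair s.code t.code)
  | .mul s t => Nat.pair 5 (Nat.pair s.code t.code)

def TermV.code : TermV → ℕ
  | .var n => Nat.pair 0 n
  | .zero => Nat.pair 1 0
  | .infty => Nat.pair 2 0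
  | .add s t => Nat.pair 3 (Nat.pair s.code t.code)
  | .val s => Nat.pair 4 s.code

def TermR.code : TermR → ℕ
  | .var n => Nat.pair 0 n
  | .zero => Nat.pair 1 0
  | .one => Nat.pair 2 0
  | .neg s => Nat.pair 3 s.code
  | .add s t => Nat.pair 4 (Nat.pair s.code t.code)
  | .mul s t => Nat.pair 5 (Nat.pair s.code t.code)
  | .res s => Nat.pair 6 s.code

def Formula.code : Formula → ℕ
  | .eqK s t => Nat.pair 0 (Nat.pair s.code t.code)
  | .eqV s t => Nat.pair 1 (Nat.pair s.code t.code)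
  | .eqR s t => Nat.pair 2 (Nat.pair s.code t.code)
  | .ltV s t => Nat.pair 3 (Nat.pair s.code t.code)
  | .not φ => Nat.pair 4 φ.code
  | .and φ ψ => Nat.pair 5 (Nat.pair φ.code ψ.code)
  | .exK n φ => Nat.pair 6 (Nat.pair n φ.code)
  | .exV n φ => Nat.pair 7 (Nat.pair n φ.code)
  | .exR n φ => Nat.pair 8 (Nat.pair n φ.code)

theorem TermK.code_injective : Function.Injective TermK.code := by
  intro s
  induction s with
  | var | zero | one => intro t; cases t <;> simp [TermK.code]
  | neg a iha =>
    intro t; cases t <;> simp [TermK.code]; exact fun h => iha h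
  | add a b iha ihb | mul a b iha ihb =>
    intro t; cases t <;> simp [TermK.code]; exact fun h h' => ⟨iha h, ihb h'⟩

theorem TermV.code_injective : Function.Injective TermV.code := by
  intro s
  induction s with
  | var | zero | infty => intro t; cases t <;> simp [TermV.code]
  | val a => intro t; cases t <;> simp [TermV.code]; exact fun h => TermK.code_injective h
  | add a b iha ihb =>
    intro t; cases t <;> simp [TermV.code]; exact fun h h' => ⟨iha h, ihb h'⟩

theorem TermR.code_injective : Function.Injective TermR.code := by
  intro s
  induction s with
  | var | zero | one => intro t; cases t <;> simp [TermR.code]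
  | neg a iha =>
    intro t; cases t <;> simp [TermR.code]; exact fun h => iha h
  | res a => intro t; cases t <;> simp [TermR.code]; exact fun h => TermK.code_injective h
  | add a b iha ihb | mul a b iha ihb =>
    intro t; cases t <;> simp [TermR.code]; exact fun h h' => ⟨iha h, ihb h'⟩

theorem Formula.code_injective : Function.Injective Formula.code := by
  intro s
  induction s with
  | eqK a b =>
    intro t; cases t <;> simp [Formula.code]
    exact fun h h' => ⟨TermK.code_injective h, TermK.code_injective h'⟩
  | eqV a b | ltV a b =>
    intro t; cases t <;> simp [Formula.code]
    exact fun h h' => ⟨TermV.code_injective h, TermV.code_injective h'⟩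
  | eqR a b =>
    intro t; cases t <;> simp [Formula.code]
    exact fun h h' => ⟨TermR.code_injective h, TermR.code_injective h'⟩
  | not a iha =>
    intro t; cases t <;> simp [Formula.code]; exact fun h => iha h
  | and a b iha ihb =>
    intro t; cases t <;> simp [Formula.code]; exact fun h h' => ⟨iha h, ihb h'⟩
  | exK n a iha | exV n a iha | exR n a iha =>
    intro t; cases t <;> simp [Formula.code]; exact fun h h' => ⟨h, iha h'⟩

end LRes

/-- An `L_res`-structure on the rings `K` and `k` and on `V`: the remaining symbols `v` and `res`
are interpreted by `val` and `res`, all other symbols by the operations on `K`, `V` and `k`. -/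
structure LResStructure (K V k : Type*) [Ring K] [Zero V] [Top V] [Add V] [LT V] [Ring k] where
  val : K → V
  res : K → k

namespace LResStructure

open LRes

variable {K V k : Type*} [Ring K] [Zero V] [Top V] [Add V] [LT V] [Ring k]

/-- An assignment of elements of `K`, `V` and `k` to the variables of the three sorts. -/
structure Assignment (K V k : Type*) where
  toK : ℕ → K
  toV : ℕ → V
  toR : ℕ → k

def evalK (e : Assignment K V k) : TermK → K
  | .var n => e.toK n
  | .zero => 0
  | .one => 1
  | .neg s => -evalK e s
  | .add s t => evalK e s + evalK e t
  | .mul s t => evalK e s * evalK e t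

variable (M : LResStructure K V k)

def evalV (e : Assignment K V k) : TermV → V
  | .var n => e.toV n
  | .zero => 0
  | .infty => ⊤
  | .add s t => evalV e s + evalV e t
  | .val s => M.val (evalK e s)

def evalR (e : Assignment K V k) : TermR → k
  | .var n => e.toR n
  | .zero => 0
  | .one => 1
  | .neg s => -evalR e s
  | .add s t => evalR e s + evalR e t
  | .mul s t => evalR e s * evalR e t
  | .res s => M.res (evalK e s)

/-- Tarski's satisfaction relation. -/
def Satisfies : Assignment K V k → Formula → Prop
  | e, .eqK s t => evalK e s = evalK e t
  | e, .eqV s t => M.evalV e s = M.evalV e t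
  | e, .eqR s t => M.evalR e s = M.evalR e t
  | e, .ltV s t => M.evalV e s < M.evalV e t
  | e, .not φ => ¬ Satisfies e φ
  | e, .and φ ψ => Satisfies e φ ∧ Satisfies e ψ
  | e, .exK n φ => ∃ x : K, Satisfies { e with toK := Function.update e.toK n x } φ
  | e, .exV n φ => ∃ x : V, Satisfies { e with toV := Function.update e.toV n x } φ
  | e, .exR n φ => ∃ x : k, Satisfies { e with toR := Function.update e.toR n x } φ

/-- `M` is undecidable if no algorithm decides, given (the Gödel number of) a sentence, whether
it is true in `M`. -/
def Undecidable : Prop :=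
  ¬ ComputablePred fun n : ℕ =>
    ∃ φ : Formula, φ.code = n ∧ φ.IsSentence ∧ ∀ e : Assignment K V k, M.Satisfies e φ

/-- Tuples of `p` elements of `K`, `q` elements of `V` and `r` elements of `k`. -/
abbrev Tuple (K V k : Type*) (p q r : ℕ) : Type _ := (Fin p → K) × (Fin q → V) × (Fin r → k)

/-- A set of `n`-tuples of elements of `K ^ p × V ^ q × k ^ r` is definable without parameters
if membership is expressed by a formula, in which the `i`-th coordinate, in the respective sort,
of the `j`-th tuple is the variable with the name `⟨j, i⟩`. As this has to hold for all
assignments, the truth of the formula depends on no other variables. -/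
def Definable {n p q r : ℕ} (S : Set (Fin n → Tuple K V k p q r)) : Prop :=
  ∃ φ : Formula, ∀ e : Assignment K V k, M.Satisfies e φ ↔
    (fun j : Fin n => ((fun i : Fin p => e.toK (Nat.pair j i), fun i : Fin q => e.toV (Nat.pair j i),
      fun i : Fin r => e.toR (Nat.pair j i)) : Tuple K V k p q r)) ∈ S

/-- `M` interprets the first-order structure `N` without parameters: there is a surjection `f`
onto `N` from a parameter-free definable set `X` of tuples of `M`, such that the preimages under
`f` of the equality of `N`, of the graph of every function symbol and of every relation symbol
are definable without parameters in `M`. -/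
def Interprets (L : FirstOrder.Language) (N : Type*) [L.Structure N] : Prop :=
  ∃ (p q r : ℕ) (X : Set (Tuple K V k p q r)) (f : X → N),
    Function.Surjective f ∧
    M.Definable {x : Fin 1 → Tuple K V k p q r | x 0 ∈ X} ∧
    M.Definable {x : Fin 2 → Tuple K V k p q r |
      ∃ h : ∀ j, x j ∈ X, f ⟨x 0, h 0⟩ = f ⟨x 1, h 1⟩} ∧
    (∀ (n : ℕ) (F : L.Functions n), M.Definable {x : Fin (n + 1) → Tuple K V k p q r |
      ∃ h : ∀ j, x j ∈ X, FirstOrder.Language.Structure.funMap F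
        (fun j : Fin n => f ⟨x j.castSucc, h _⟩) = f ⟨x (Fin.last n), h _⟩}) ∧
    (∀ (n : ℕ) (R : L.Relations n), M.Definable {x : Fin n → Tuple K V k p q r |
      ∃ h : ∀ j, x j ∈ X, FirstOrder.Language.Structure.RelMap R (fun j => f ⟨x j, h j⟩)})

end LResStructure

/-- The function symbols `+` and `·` of arithmetic. -/
inductive ArithFunc : ℕ → Type
  | add : ArithFunc 2
  | mul : ArithFunc 2

/-- The language of arithmetic, with the two binary function symbols `+` and `·`. -/
def arithLanguage : FirstOrder.Language where
  Functions := ArithFunc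
  Relations := fun _ => Empty

/-- The structure `(ℕ, +, ·)`. -/
instance arithStructure : arithLanguage.Structure ℕ where
  funMap := fun {_} F x =>
    match F, x with
    | .add, x => x 0 + x 1
    | .mul, x => x 0 * x 1
  RelMap := fun {_} R _ => nomatch R

noncomputable section

/-- The Hahn series field `k((t^Γ))` with its valuation `v_t` and its total residue map, which
picks out the coefficient of `t ^ 0`. -/
def hahnRes (k : Type u) (Γ : Type v) [Field k] [AddCommGroup Γ] [LinearOrder Γ]
    [IsOrderedAddMonoid Γ] : LResStructure (HahnSeries Γ k) (WithTop Γ) k where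
  val := HahnSeries.addVal Γ k
  res x := x.coeff 0

/-- The order embedding `ℤ → ℚ`, `z ↦ z / n`, of groups. -/
def intDiv (n : ℕ+) : ℤ →+ ℚ where
  toFun z := (z : ℚ) / (n : ℕ)
  map_zero' := by simp
  map_add' a b := by push_cast; ring

theorem intDiv_le_iff (n : ℕ+) (a b : ℤ) : intDiv n a ≤ intDiv n b ↔ a ≤ b := by
  have hn : (0 : ℚ) < (n : ℕ) := by exact_mod_cast n.pos
  change (a : ℚ) / (n : ℕ) ≤ (b : ℚ) / (n : ℕ) ↔ a ≤ b
  rw [div_le_div_iff_of_pos_right hn]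
  exact Int.cast_le

theorem intDiv_injective (n : ℕ+) : Function.Injective (intDiv n) := fun a b h =>
  le_antisymm ((intDiv_le_iff n a b).1 h.le) ((intDiv_le_iff n b a).1 h.ge)

/-- The embedding of `k((t))` into `k((t^ℚ))` given by `t ↦ t ^ (1 / n)`. -/
def laurentRoot (k : Type u) [Field k] (n : ℕ+) : HahnSeries ℤ k →+* HahnSeries ℚ k :=
  HahnSeries.embDomainRingHom (intDiv n) (intDiv_injective n) (intDiv_le_iff n)

theorem laurentRoot_range_le (k : Type u) [Field k] (n m : ℕ+) :
    (laurentRoot k n).fieldRange ≤ (laurentRoot k (n * m)).fieldRange := by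
  have hn : ((n : ℕ) : ℚ) ≠ 0 := by exact_mod_cast n.ne_zero
  have hm : ((m : ℕ) : ℚ) ≠ 0 := by exact_mod_cast m.ne_zero
  have hm' : (0 : ℤ) < (m : ℕ) := by exact_mod_cast m.pos
  rintro _ ⟨x, rfl⟩
  let g : ℤ ↪o ℤ := OrderEmbedding.ofMapLEIff (fun z => z * (m : ℕ))
    (fun a b => mul_le_mul_iff_left₀ hm')
  refine ⟨HahnSeries.embDomain g x, ?_⟩
  have key : ∀ z : ℤ, intDiv n z = intDiv (n * m) (g z) := by
    intro z
    change (z : ℚ) / (n : ℕ) = ((z * (m : ℕ) : ℤ) : ℚ) / ((n * m : ℕ+) : ℕ)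
    push_cast
    field_simp
  ext q
  change (HahnSeries.embDomain _ (HahnSeries.embDomain g x)).coeff q =
    (HahnSeries.embDomain _ x).coeff q
  by_cases hq : q ∈ Set.range (intDiv n)
  · obtain ⟨z, rfl⟩ := hq
    have h2 := HahnSeries.embDomain_coeff (f := (⟨⟨intDiv n, intDiv_injective n⟩,
      intDiv_le_iff n _ _⟩ : ℤ ↪o ℚ)) (x := x) (a := z)
    refine Eq.trans ?_ h2.symm
    rw [key z]
    have h1 := HahnSeries.embDomain_coeff (f := (⟨⟨intDiv (n * m), intDiv_injective _⟩,
      intDiv_le_iff (n * m) _ _⟩ : ℤ ↪o ℚ)) (x := HahnSeries.embDomain g x) (a := g z)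
    exact h1.trans HahnSeries.embDomain_coeff
  · refine Eq.trans ?_ (HahnSeries.embDomain_of_notMem_range hq).symm
    by_cases hq' : q ∈ Set.range (intDiv (n * m))
    · obtain ⟨z, rfl⟩ := hq'
      have h1 := HahnSeries.embDomain_coeff (f := (⟨⟨intDiv (n * m), intDiv_injective _⟩,
        intDiv_le_iff (n * m) _ _⟩ : ℤ ↪o ℚ)) (x := HahnSeries.embDomain g x) (a := z)
      refine h1.trans (HahnSeries.embDomain_of_notMem_range ?_)
      rintro ⟨w, rfl⟩
      exact hq ⟨w, key w⟩
    · exact HahnSeries.embDomain_of_notMem_range hq'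

/-- The Puiseux series field `k{{t}}`, the union over `n ≥ 1` of the fields `k((t^(1/n)))`
inside `k((t^ℚ))`. -/
def puiseux (k : Type u) [Field k] : Subfield (HahnSeries ℚ k) where
  carrier := ⋃ n : ℕ+, ((laurentRoot k n).fieldRange : Set (HahnSeries ℚ k))
  zero_mem' := Set.mem_iUnion.2 ⟨1, zero_mem _⟩
  one_mem' := Set.mem_iUnion.2 ⟨1, one_mem _⟩
  neg_mem' := fun hx => by
    obtain ⟨n, hx⟩ := Set.mem_iUnion.1 hx
    exact Set.mem_iUnion.2 ⟨n, neg_mem hx⟩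
  inv_mem' := fun _ hx => by
    obtain ⟨n, hx⟩ := Set.mem_iUnion.1 hx
    exact Set.mem_iUnion.2 ⟨n, inv_mem hx⟩
  add_mem' := fun hx hy => by
    obtain ⟨n, hx⟩ := Set.mem_iUnion.1 hx
    obtain ⟨m, hy⟩ := Set.mem_iUnion.1 hy
    exact Set.mem_iUnion.2 ⟨n * m, add_mem (laurentRoot_range_le k n m hx)
      (mul_comm m n ▸ laurentRoot_range_le k m n hy)⟩
  mul_mem' := fun hx hy => by
    obtain ⟨n, hx⟩ := Set.mem_iUnion.1 hx
    obtain ⟨m, hy⟩ := Set.mem_iUnion.1 hy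
    exact Set.mem_iUnion.2 ⟨n * m, mul_mem (laurentRoot_range_le k n m hx)
      (mul_comm m n ▸ laurentRoot_range_le k m n hy)⟩

/-- The Puiseux series field with its valuation `v_t` and its total residue map. -/
def puiseuxRes (k : Type u) [Field k] : LResStructure (puiseux k) (WithTop ℚ) k where
  val x := HahnSeries.addVal ℚ k (x : HahnSeries ℚ k)
  res x := (x : HahnSeries ℚ k).coeff 0

end

/-! Arithmetic is reached through the polynomial ring `k[X]`. A pair `(t, y)` in `K` with `v(t) > 0`
codes the sequence `res (y * t ^ n)`. Since a value group of rank one is archimedean, `v(y * t ^ n)`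
is positive for large `n`, so the sequence has finite support and is the coefficient sequence of a
polynomial `P`. Conversely, any nonzero `t` of positive value yields codes for all polynomials
(`exists_code`).

Coefficients are not accessible to a first-order formula, but values are: expanding a geometric
series gives `P(c) = res (y / (1 - c * t))` for constants `c` (`eval_eq`). The field of constants is
definable in `K`, as the set of `a` with `res (a * x) = res a * res x` for all `x`. As `k` is
infinite, polynomials are determined by their values, so equality, sum, product and the polynomial
`X` are definable on codes (`polyClosed`).

In `k[X]` the number `n` is represented by `X ^ n`. The powers of `X` are definable, addition of
exponents is multiplication of powers, and `n ∣ m` holds iff `X ^ n - 1 ∣ X ^ m - 1`. Multiplication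
of natural numbers is definable from addition and divisibility (`ArithClosed.of_dvd`). This gives
the interpretation.

For undecidability, Gödel's beta function makes the graphs of partial recursive functions
arithmetical, hence also the halting set `H`. A sentence expressing `H n` is built primitive
recursively from `n`, by applying the definable successor `n` times to zero. Deciding truth would
therefore decide `H`.

Hahn and Puiseux series enter only through the axioms `IsTotalResidue`. -/

/-! ### First-order closed families of relations -/

/-- A family of finitary relations on `A` that contains equality and is closed under the
first-order operations. -/
structure FOClosed {A : Type*} (D : ∀ n : ℕ, ((Fin n → A) → Prop) → Prop) : Prop where
  eq : ∀ {n} (i j : Fin n), D n fun x => x i = x j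
  not : ∀ {n} {R : (Fin n → A) → Prop}, D n R → D n fun x => ¬ R x
  and : ∀ {n} {R S : (Fin n → A) → Prop}, D n R → D n S → D n fun x => R x ∧ S x
  ex : ∀ {n} {R : (Fin n → A) → A → Prop},
    D (n + 1) (fun y => R (fun i => y i.succ) (y 0)) → D n fun x => ∃ a, R x a
  reindex : ∀ {n m} {R : (Fin n → A) → Prop} (σ : Fin n → Fin m),
    D n R → D m fun x => R fun i => x (σ i)

/-- The graph of `f` belongs to the family `D`. -/
def DFun {A : Type*} (D : ∀ n : ℕ, ((Fin n → A) → Prop) → Prop) {n : ℕ}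
    (f : (Fin n → A) → A) : Prop :=
  D (n + 1) fun y => y 0 = f fun i => y i.succ

namespace FOClosed

variable {A : Type*} {D : ∀ n : ℕ, ((Fin n → A) → Prop) → Prop} (h : FOClosed D)

include h

omit h in
theorem congr {n : ℕ} {R S : (Fin n → A) → Prop} (hR : D n R) (hRS : ∀ x, S x ↔ R x) : D n S := by
  have : S = R := funext fun x => propext (hRS x)
  rwa [this]

theorem or {n : ℕ} {R S : (Fin n → A) → Prop} (hR : D n R) (hS : D n S) :
    D n fun x => R x ∨ S x :=
  congr (h.not (h.and (h.not hR) (h.not hS))) fun x => by tauto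

theorem imp {n : ℕ} {R S : (Fin n → A) → Prop} (hR : D n R) (hS : D n S) :
    D n fun x => R x → S x :=
  congr (h.or (h.not hR) hS) fun x => by tauto

theorem iff {n : ℕ} {R S : (Fin n → A) → Prop} (hR : D n R) (hS : D n S) :
    D n fun x => (R x ↔ S x) :=
  congr (h.and (h.imp hR hS) (h.imp hS hR)) fun x => by tauto

theorem all {n : ℕ} {R : (Fin n → A) → A → Prop}
    (hR : D (n + 1) (fun y => R (fun i => y i.succ) (y 0))) : D n fun x => ∀ a, R x a :=
  congr (h.not (h.ex (R := fun x a => ¬ R x a) (h.not hR))) fun x => by simp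

theorem true {n : ℕ} : D n fun _ => True :=
  congr (h.all (R := fun _ a => a = a) (h.eq 0 0)) fun x => by simp

theorem forall_fin {n m : ℕ} {R : Fin m → (Fin n → A) → Prop} (hR : ∀ i, D n (R i)) :
    D n fun x => ∀ i, R i x := by
  induction m with
  | zero => exact congr h.true fun x => by simp
  | succ m ih =>
    exact congr (h.and (hR 0) (ih fun i => hR i.succ)) fun x => Fin.forall_fin_succ

/-- Substitution of a definable function. -/
theorem subst {n : ℕ} {R : (Fin n → A) → A → Prop} {f : (Fin n → A) → A} (hf : DFun D f)
    (hR : D (n + 1) (fun y => R (fun i => y i.succ) (y 0))) : D n fun x => R x (f x) :=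
  congr (h.ex (R := fun x a => a = f x ∧ R x a) (h.and hf hR)) fun x => by simp

theorem var {n : ℕ} (i : Fin n) : DFun D fun x => x i :=
  h.eq 0 i.succ

theorem weaken {n : ℕ} {f : (Fin n → A) → A} (hf : DFun D f) :
    DFun D fun x : Fin (n + 1) → A => f fun i => x i.succ :=
  h.reindex (m := n + 2) (Fin.cons 0 fun i => i.succ.succ) hf

/-- Definability of `Q` is required on variables in every arity because each substituted function
value becomes a new bound variable. -/
theorem app₂ {Q : A → A → Prop} (hQ : ∀ {n} (i j : Fin n), D n fun x => Q (x i) (x j)) {n : ℕ}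
    {f g : (Fin n → A) → A} (hf : DFun D f) (hg : DFun D g) : D n fun x => Q (f x) (g x) :=
  h.subst (R := fun x a => Q a (g x)) hf <|
    h.subst (R := fun y a => Q (y 0) a) (h.weaken hg) (hQ _ _)

theorem app₃ {Q : A → A → A → Prop}
    (hQ : ∀ {n} (i j l : Fin n), D n fun x => Q (x i) (x j) (x l)) {n : ℕ}
    {f g u : (Fin n → A) → A} (hf : DFun D f) (hg : DFun D g) (hu : DFun D u) :
    D n fun x => Q (f x) (g x) (u x) :=
  h.subst (R := fun x a => Q a (g x) (u x)) hf <|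
    h.subst (R := fun y a => Q (y 0) a (u fun i => y i.succ)) (h.weaken hg) <|
    h.subst (R := fun y a => Q (y 1) (y 0) a) (h.weaken (h.weaken hu)) (hQ _ _ _)

theorem eq' {n : ℕ} {f g : (Fin n → A) → A} (hf : DFun D f) (hg : DFun D g) :
    D n fun x => f x = g x :=
  h.app₂ h.eq hf hg

theorem const {a : A} (ha : D 1 fun x => x 0 = a) {n : ℕ} : DFun D fun _ : Fin n → A => a :=
  h.reindex (fun _ => 0) ha

theorem comp₁ {F : A → A} (hF : ∀ {n} (i j : Fin n), D n fun x => x i = F (x j)) {n : ℕ}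
    {f : (Fin n → A) → A} (hf : DFun D f) : DFun D fun x => F (f x) :=
  h.app₂ (Q := fun a b => a = F b) hF (h.var 0) (h.weaken hf)

theorem comp₂ {F : A → A → A} (hF : ∀ {n} (i j l : Fin n), D n fun x => x i = F (x j) (x l))
    {n : ℕ} {f g : (Fin n → A) → A} (hf : DFun D f) (hg : DFun D g) :
    DFun D fun x => F (f x) (g x) :=
  h.app₃ (Q := fun a b c => a = F b c) hF (h.var 0) (h.weaken hf) (h.weaken hg)

end FOClosed

/-! ### Families induced by a coding -/

/-- The relations on `B` whose preimages under the coding `C` of elements of `B` by pairs of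
elements of `A` belong to `D`. -/
def Coded {A B : Type*} (D : ∀ n : ℕ, ((Fin n → A) → Prop) → Prop) (C : A → A → B → Prop)
    (n : ℕ) (R : (Fin n → B) → Prop) : Prop :=
  ∀ (m : ℕ) (σ τ : Fin n → Fin m),
    D m fun x => ∃ b : Fin n → B, (∀ i, C (x (σ i)) (x (τ i)) (b i)) ∧ R b

/-- `C` is a coding of all elements of `B` by pairs from a definable set. -/
structure IsCoding {A B : Type*} (D : ∀ n : ℕ, ((Fin n → A) → Prop) → Prop)
    (C : A → A → B → Prop) : Prop where
  unique : ∀ {a a' b b'}, C a a' b → C a a' b' → b = b'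
  surj : ∀ b, ∃ a a', C a a' b
  dom : ∀ {n} (i j : Fin n), D n fun x => ∃ b, C (x i) (x j) b

namespace FOClosed

variable {A B : Type*} {D : ∀ n : ℕ, ((Fin n → A) → Prop) → Prop} (h : FOClosed D)
  {C : A → A → B → Prop} (hC : IsCoding D C)

include h hC

/-- It suffices to describe `R` by a condition on codes that is correct for every choice of codes;
definability of the set of codes does the rest. -/
theorem coded_of {n : ℕ} {R : (Fin n → B) → Prop} (S : (Fin n → A) → (Fin n → A) → Prop)
    (hS : ∀ {m : ℕ} (σ τ : Fin n → Fin m), D m fun x => S (fun i => x (σ i)) fun i => x (τ i))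
    (hRS : ∀ a a' b, (∀ i, C (a i) (a' i) (b i)) → (R b ↔ S a a')) : Coded D C n R := by
  intro m σ τ
  refine congr (h.and (h.forall_fin fun i => hC.dom (σ i) (τ i)) (hS σ τ)) fun x => ?_
  constructor
  · rintro ⟨b, hb, hR⟩
    exact ⟨fun i => ⟨_, hb i⟩, (hRS _ _ _ hb).1 hR⟩
  · rintro ⟨hb, hR⟩
    choose b hb using hb
    exact ⟨b, hb, (hRS _ _ _ hb).2 hR⟩

/-- A code has only one decoding, so decoding commutes with the connectives. A quantifier over `B`
becomes two quantifiers over `A`, since every element of `B` has a code. -/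
theorem coded (heq : Coded D C 2 fun x => x 0 = x 1) : FOClosed (Coded D C) where
  eq {n} i j m σ τ := by
    refine congr (h.and (h.forall_fin fun i => hC.dom (σ i) (τ i))
      (heq m ![σ i, σ j] ![τ i, τ j])) fun x => ?_
    constructor
    · rintro ⟨b, hb, hij⟩
      refine ⟨fun i => ⟨_, hb i⟩, ![b i, b j], ?_, hij⟩
      intro l
      fin_cases l
      · exact hb i
      · exact hb j
    · rintro ⟨hb, c, hc, hij⟩
      choose b hb using hb
      refine ⟨b, hb, ?_⟩
      have h0 := hC.unique (hb i) (hc 0)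
      have h1 := hC.unique (hb j) (hc 1)
      exact h0.trans (hij.trans h1.symm)
  not {n R} hR m σ τ := by
    refine congr (h.and (h.forall_fin fun i => hC.dom (σ i) (τ i)) (h.not (hR m σ τ)))
      fun x => ?_
    constructor
    · rintro ⟨b, hb, hn⟩
      refine ⟨fun i => ⟨_, hb i⟩, ?_⟩
      rintro ⟨c, hc, hRc⟩
      have : b = c := funext fun i => hC.unique (hb i) (hc i)
      exact hn (this ▸ hRc)
    · rintro ⟨hb, hn⟩
      choose b hb using hb
      exact ⟨b, hb, fun hRb => hn ⟨b, hb, hRb⟩⟩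
  and {n R S} hR hS m σ τ := by
    refine congr (h.and (hR m σ τ) (hS m σ τ)) fun x => ?_
    constructor
    · rintro ⟨b, hb, hRb, hSb⟩
      exact ⟨⟨b, hb, hRb⟩, ⟨b, hb, hSb⟩⟩
    · rintro ⟨⟨b, hb, hRb⟩, ⟨c, hc, hSc⟩⟩
      have : b = c := funext fun i => hC.unique (hb i) (hc i)
      exact ⟨b, hb, hRb, this ▸ hSc⟩
  ex {n R} hR m σ τ := by
    refine congr (h.ex (R := fun x a => ∃ a', ∃ b : Fin (n + 1) → B,
      (∀ i : Fin (n + 1), C ((Fin.cons a fun i => x (σ i) : Fin (n + 1) → A) i)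
        ((Fin.cons a' fun i => x (τ i) : Fin (n + 1) → A) i) (b i)) ∧
      R (fun i => b i.succ) (b 0)) (h.ex ?_)) fun x => ?_
    -- Of the two new variables, the inner one `a'` has index `0` and the outer one `a` has index
    -- `1`.
    · refine congr (hR (m + 2) (Fin.cons 1 fun i => (σ i).succ.succ)
        (Fin.cons 0 fun i => (τ i).succ.succ)) fun x => ?_
      simp only [Fin.forall_fin_succ, Fin.cons_zero, Fin.cons_succ, Fin.succ_zero_eq_one]
    · constructor
      · rintro ⟨b, hb, c, hR⟩
        obtain ⟨a, a', hc⟩ := hC.surj c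
        refine ⟨a, a', Fin.cons c b, ?_, hR⟩
        intro i
        refine Fin.cases ?_ (fun i => ?_) i
        · exact hc
        · exact hb i
      · rintro ⟨a, a', b, hb, hR⟩
        exact ⟨fun i => b i.succ, fun i => hb i.succ, b 0, hR⟩
  reindex {n n' R} ρ hR m σ τ := by
    refine congr (h.and (h.forall_fin fun i => hC.dom (σ i) (τ i))
      (hR m (fun i => σ (ρ i)) fun i => τ (ρ i))) fun x => ?_
    constructor
    · rintro ⟨b, hb, hRb⟩
      exact ⟨fun i => ⟨_, hb i⟩, _, fun i => hb (ρ i), hRb⟩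
    · rintro ⟨hb, c, hc, hRc⟩
      choose b hb using hb
      refine ⟨b, hb, ?_⟩
      have : c = fun i => b (ρ i) := funext fun i => hC.unique (hc i) (hb (ρ i))
      subst this
      exact hRc

end FOClosed

/-! ### Arithmetical relations -/

/-- A first-order closed family of relations on `ℕ` that contains the graphs of addition and
multiplication. -/
structure ArithClosed (D : ∀ n : ℕ, ((Fin n → ℕ) → Prop) → Prop) : Prop extends FOClosed D where
  add : ∀ {n} (i j l : Fin n), D n fun x => x i = x j + x l
  mul : ∀ {n} (i j l : Fin n), D n fun x => x i = x j * x l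

namespace ArithClosed

open FOClosed (congr)

variable {D : ∀ n : ℕ, ((Fin n → ℕ) → Prop) → Prop} (h : ArithClosed D)

include h

theorem fadd {n : ℕ} {f g : (Fin n → ℕ) → ℕ} (hf : DFun D f) (hg : DFun D g) :
    DFun D fun x => f x + g x :=
  h.comp₂ (F := fun a b => a + b) h.add hf hg

theorem fmul {n : ℕ} {f g : (Fin n → ℕ) → ℕ} (hf : DFun D f) (hg : DFun D g) :
    DFun D fun x => f x * g x :=
  h.comp₂ (F := fun a b => a * b) h.mul hf hg

theorem fzero {n : ℕ} : DFun D fun _ : Fin n → ℕ => 0 :=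
  h.const (congr (h.add 0 0 0) fun x => by omega)

/-- The number `1` is the idempotent that differs from its double. -/
theorem fone {n : ℕ} : DFun D fun _ : Fin n → ℕ => 1 :=
  h.const (congr (h.and (h.mul 0 0 0) (h.not (h.add 0 0 0))) fun x => by
    generalize x 0 = a
    constructor
    · rintro rfl
      simp
    · rintro ⟨h1, h2⟩
      have h3 : a ≠ 0 := by omega
      exact (Nat.eq_of_mul_eq_mul_left (Nat.pos_of_ne_zero h3) (by omega)).symm)

theorem lt {n : ℕ} {f g : (Fin n → ℕ) → ℕ} (hf : DFun D f) (hg : DFun D g) :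
    D n fun x => f x < g x :=
  h.app₂ (Q := fun a b => a < b) (fun i j => congr (h.ex (R := fun x a => x j = x i + (a + 1))
    (h.eq' (h.var _) (h.fadd (h.var _) (h.fadd (h.var _) h.fone)))) fun x => by
      constructor
      · intro hx
        exact ⟨x j - x i - 1, by omega⟩
      · rintro ⟨a, ha⟩
        omega) hf hg

theorem fpair {n : ℕ} {f g : (Fin n → ℕ) → ℕ} (hf : DFun D f) (hg : DFun D g) :
    DFun D fun x => Nat.pair (f x) (g x) :=
  h.comp₂ (F := Nat.pair) (fun i j l => congr
    (h.or (h.and (h.lt (h.var j) (h.var l)) (h.eq' (h.var i)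
        (h.fadd (h.fmul (h.var l) (h.var l)) (h.var j))))
      (h.and (h.not (h.lt (h.var j) (h.var l))) (h.eq' (h.var i)
        (h.fadd (h.fadd (h.fmul (h.var j) (h.var j)) (h.var j)) (h.var l))))) fun x => by
      rw [Nat.pair]
      split_ifs with hjl <;> simp [hjl]) hf hg

theorem funpair_fst {n : ℕ} {f : (Fin n → ℕ) → ℕ} (hf : DFun D f) :
    DFun D fun x => (f x).unpair.1 :=
  h.comp₁ (F := fun a => a.unpair.1) (fun i j => congr (h.ex (R := fun x a => x j = Nat.pair (x i) a)
    (h.eq' (h.var _) (h.fpair (h.var _) (h.var _)))) fun x => by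
      constructor
      · intro hx
        exact ⟨(x j).unpair.2, by rw [hx, Nat.pair_unpair]⟩
      · rintro ⟨a, ha⟩
        simp [ha]) hf

theorem funpair_snd {n : ℕ} {f : (Fin n → ℕ) → ℕ} (hf : DFun D f) :
    DFun D fun x => (f x).unpair.2 :=
  h.comp₁ (F := fun a => a.unpair.2) (fun i j => congr (h.ex (R := fun x a => x j = Nat.pair a (x i))
    (h.eq' (h.var _) (h.fpair (h.var _) (h.var _)))) fun x => by
      constructor
      · intro hx
        exact ⟨(x j).unpair.1, by rw [hx, Nat.pair_unpair]⟩
      · rintro ⟨a, ha⟩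
        simp [ha]) hf

/-- The graph of the remainder of the division by a successor. -/
theorem fmod_succ {n : ℕ} {f g : (Fin n → ℕ) → ℕ} (hf : DFun D f) (hg : DFun D g) :
    DFun D fun x => f x % (g x + 1) :=
  h.comp₂ (F := fun a b => a % (b + 1)) (fun i j l => congr
    (h.and (h.lt (h.var i) (h.fadd (h.var l) h.fone))
      (h.ex (R := fun x a => x j = x i + (x l + 1) * a) (h.eq' (h.var _)
        (h.fadd (h.var _) (h.fmul (h.fadd (h.var _) h.fone) (h.var _)))))) fun x => by
      constructor
      · intro hx
        rw [hx]
        exact ⟨Nat.mod_lt _ (Nat.succ_pos _), x j / (x l + 1), (Nat.mod_add_div _ _).symm⟩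
      · rintro ⟨hi, a, ha⟩
        rw [ha, Nat.add_mul_mod_self_left, Nat.mod_eq_of_lt hi]) hf hg

theorem fbeta {n : ℕ} {f g : (Fin n → ℕ) → ℕ} (hf : DFun D f) (hg : DFun D g) :
    DFun D fun x => Nat.beta (f x) (g x) :=
  h.fmod_succ (h.funpair_fst hf) (h.fmul (h.fadd hg h.fone) (h.funpair_snd hf))

end ArithClosed

/-- Through this, quantifying over finite sequences is quantifying over single numbers, which is
what makes recursion arithmetical. -/
theorem exists_beta_eq (a : ℕ → ℕ) (n : ℕ) : ∃ s, ∀ i < n, Nat.beta s i = a i := by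
  refine ⟨Nat.unbeta (List.ofFn fun i : Fin n => a i), fun i hi => ?_⟩
  have := Nat.beta_unbeta_coe (List.ofFn fun i : Fin n => a i) ⟨i, by simpa using hi⟩
  simpa using this

/-- The values of a function defined by primitive recursion are characterized by the existence
of a sequence of intermediate values, coded by the beta function. -/
theorem mem_rec_iff_exists_beta (f g : ℕ →. ℕ) (a n z : ℕ) :
    (z ∈ (n.rec (f a) fun y IH => IH.bind fun i => g (Nat.pair a (Nat.pair y i)) : Part ℕ)) ↔
      ∃ s, Nat.beta s 0 ∈ f a ∧
        (∀ y, y < n → Nat.beta s (y + 1) ∈ g (Nat.pair a (Nat.pair y (Nat.beta s y)))) ∧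
        z = Nat.beta s n := by
  constructor
  · intro hz
    have key : ∃ u : ℕ → ℕ, u 0 ∈ f a ∧
        (∀ y, y < n → u (y + 1) ∈ g (Nat.pair a (Nat.pair y (u y)))) ∧ z = u n := by
      induction n generalizing z with
      | zero => exact ⟨fun _ => z, hz, by simp, rfl⟩
      | succ n ih =>
        obtain ⟨w, hw, hz⟩ := Part.mem_bind_iff.1 hz
        obtain ⟨u, h0, hs, rfl⟩ := ih w hw
        refine ⟨fun i => if i ≤ n then u i else z, by simpa using h0, fun y hy => ?_, by simp⟩
        rcases Nat.lt_succ_iff_lt_or_eq.1 hy with hy | rfl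
        · simpa [hy.le, Nat.succ_le_of_lt hy] using hs y hy
        · simpa using hz
    obtain ⟨u, h0, hs, rfl⟩ := key
    obtain ⟨s, hβ⟩ := exists_beta_eq u (n + 1)
    refine ⟨s, ?_, fun y hy => ?_, (hβ n (by omega)).symm⟩
    · rwa [hβ 0 (by omega)]
    · rw [hβ (y + 1) (by omega), hβ y (by omega)]
      exact hs y hy
  · rintro ⟨s, h0, hs, rfl⟩
    induction n with
    | zero => exact h0
    | succ n ih =>
      exact Part.mem_bind_iff.2 ⟨_, ih fun y hy => hs y (by omega), hs n (by omega)⟩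

namespace ArithClosed

open FOClosed (congr)

variable {D : ∀ n : ℕ, ((Fin n → ℕ) → Prop) → Prop} (h : ArithClosed D)

include h

/-- The graphs of partial recursive functions are arithmetical. -/
theorem partrec {p : ℕ →. ℕ} (hp : Nat.Partrec p) {n : ℕ} (i j : Fin n) :
    D n fun x => x i ∈ p (x j) := by
  induction hp generalizing n with
  | zero =>
    exact congr (h.eq' (h.var i) h.fzero) fun x => by simp [pure, PFun.pure]
  | succ =>
    exact congr (h.eq' (h.var i) (h.fadd (h.var j) h.fone)) fun x => by simp
  | left =>
    exact congr (h.eq' (h.var i) (h.funpair_fst (h.var j))) fun x => by simp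
  | right =>
    exact congr (h.eq' (h.var i) (h.funpair_snd (h.var j))) fun x => by simp
  | @pair f g _ _ hf hg =>
    refine congr (h.ex (R := fun x a => a ∈ f (x j) ∧ ∃ b, b ∈ g (x j) ∧ x i = Nat.pair a b)
      (h.and (hf _ _) (h.ex (h.and (hg _ _)
        (h.eq' (h.var _) (h.fpair (h.var _) (h.var _))))))) fun x => ?_
    simp [Seq.seq, eq_comm]
  | @comp f g _ _ hf hg =>
    refine congr (h.ex (R := fun x a => a ∈ g (x j) ∧ x i ∈ f a) (h.and (hg _ _) (hf _ _)))
      fun x => ?_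
    exact Part.mem_bind_iff
  | @prec f g _ _ hf hg =>
    refine congr (h.ex (R := fun x s => Nat.beta s 0 ∈ f (x j).unpair.1 ∧
        (∀ y, y < (x j).unpair.2 → Nat.beta s (y + 1) ∈
          g (Nat.pair (x j).unpair.1 (Nat.pair y (Nat.beta s y)))) ∧
        x i = Nat.beta s (x j).unpair.2)
      (h.and ?_ (h.and (h.all (h.imp ?_ ?_)) ?_))) fun x => ?_
    · exact h.app₂ (Q := fun a b => a ∈ f b) hf (h.fbeta (h.var _) h.fzero)
        (h.funpair_fst (h.var _))
    · exact h.lt (h.var _) (h.funpair_snd (h.var _))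
    · exact h.app₂ (Q := fun a b => a ∈ g b) hg (h.fbeta (h.var _) (h.fadd (h.var _) h.fone))
        (h.fpair (h.funpair_fst (h.var _)) (h.fpair (h.var _) (h.fbeta (h.var _) (h.var _))))
    · exact h.eq' (h.var _) (h.fbeta (h.var _) (h.funpair_snd (h.var _)))
    · exact mem_rec_iff_exists_beta f g _ _ _
  | @rfind f _ hf =>
    -- The search stops at the first zero of `f`, provided that all earlier values are defined and
    -- nonzero.
    refine congr (h.and
      (h.app₂ (Q := fun a b => a ∈ f b) hf h.fzero (h.fpair (h.var j) (h.var i)))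
      (h.all (R := fun x m => m < x i → ∃ w, ¬ w = 0 ∧ w ∈ f (Nat.pair (x j) m))
        (h.imp (h.lt (h.var _) (h.var _)) (h.ex (h.and (h.not (h.eq' (h.var _) h.fzero))
          (h.app₂ (Q := fun a b => a ∈ f b) hf (h.var _) (h.fpair (h.var _) (h.var _))))))))
      fun x => ?_
    refine Nat.mem_rfind.trans ?_
    simp [and_comm]

end ArithClosed

/-- There is a set of natural numbers that belongs to all arithmetically closed families and is
not computable. -/
theorem exists_arith_not_computable : ∃ H : ℕ → Prop, ¬ ComputablePred H ∧
    ∀ D, ArithClosed D → D 1 fun x => H (x 0) := by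
  -- The domain of `p` is the halting set: the numbers of the programs that halt on input `0`.
  let p : ℕ →. ℕ := fun n => (Denumerable.ofNat Nat.Partrec.Code n).eval 0
  have hp : Nat.Partrec p := Partrec.nat_iff.1
    (Nat.Partrec.Code.eval_part.comp (Computable.ofNat _) (Computable.const 0))
  refine ⟨fun n => (p n).Dom, fun hc => ComputablePred.halting_problem 0 ?_, fun D h => ?_⟩
  · refine ComputablePred.computable_of_manyOneReducible (ManyOneReducible.mk _ Computable.encode) hc |>.of_eq ?_
    intro c
    simp [p]
  · exact FOClosed.congr (h.ex (R := fun x a => a ∈ p (x 0)) (h.partrec hp _ _)) fun x =>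
      Part.dom_iff_mem

/-! ### Arithmetic in polynomial rings -/

open Polynomial

/-- Modulo `X ^ n - 1`, the polynomial `X ^ m - 1` is congruent to `X ^ (m % n) - 1`, whose degree
is below `n` when the remainder is positive. -/
theorem X_pow_sub_one_dvd_iff {k : Type*} [Field k] (n m : ℕ) :
    (X ^ n - 1 : k[X]) ∣ X ^ m - 1 ↔ n ∣ m := by
  refine ⟨fun hd => ?_, ?_⟩; swap
  · rintro ⟨l, rfl⟩
    exact pow_one_sub_dvd_pow_mul_sub_one _ _ _
  -- For `n = 0` the divisor is the zero polynomial, matching the fact that `0` divides only `0`.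
  rcases Nat.eq_zero_or_pos n with rfl | hn
  · rw [pow_zero, sub_self, zero_dvd_iff] at hd
    rcases Nat.eq_zero_or_pos m with rfl | hm
    · exact dvd_rfl
    · exact absurd hd (by simpa using X_pow_sub_C_ne_zero hm (1 : k))
  · have h1 : (X ^ n - 1 : k[X]) ∣ X ^ (n * (m / n)) - 1 :=
      pow_one_sub_dvd_pow_mul_sub_one _ _ _
    have h2 : (X ^ m - 1 : k[X]) =
        X ^ (m % n) * (X ^ (n * (m / n)) - 1) + (X ^ (m % n) - 1) := by
      rw [mul_sub, ← pow_add, Nat.mod_add_div]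
      ring
    rw [h2, dvd_add_right (h1.mul_left _)] at hd
    by_contra hnm
    have hr : 0 < m % n := Nat.pos_of_ne_zero fun h0 => hnm (Nat.dvd_of_mod_eq_zero h0)
    have hne : (X ^ (m % n) - 1 : k[X]) ≠ 0 := by simpa using X_pow_sub_C_ne_zero hr (1 : k)
    have hle := natDegree_le_of_dvd hd hne
    have e1 : (X ^ n - 1 : k[X]).natDegree = n := by
      simpa using natDegree_X_pow_sub_C (n := n) (r := (1 : k))
    have e2 : (X ^ (m % n) - 1 : k[X]).natDegree = m % n := by
      simpa using natDegree_X_pow_sub_C (n := m % n) (r := (1 : k))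
    rw [e1, e2] at hle
    exact absurd (Nat.mod_lt m hn) (by omega)

/-- The condition on divisors forces `P` to be a constant times a power of `X`, and the congruence
modulo `X - 1` normalizes the constant to `1`. Only ring equations occur, so the right-hand side is
first-order. -/
theorem exists_eq_X_pow_iff {k : Type*} [Field k] (P : k[X]) :
    (∃ n : ℕ, P = X ^ n) ↔ (∃ S, P = (X - 1) * S + 1) ∧
      ∀ Q R, P = Q * R → (∃ S, Q * S = 1) ∨ ∃ S, Q = X * S := by
  constructor
  · rintro ⟨n, rfl⟩
    constructor
    · obtain ⟨S, hS⟩ := sub_one_dvd_pow_sub_one (X : k[X]) n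
      exact ⟨S, by rw [← hS]; ring⟩
    · intro Q R hQR
      obtain ⟨i, -, hi⟩ := (dvd_prime_pow (prime_X (R := k)) n).1 (Dvd.intro R hQR.symm)
      rcases Nat.eq_zero_or_pos i with rfl | hpos
      · rw [pow_zero, associated_one_iff_isUnit] at hi
        exact Or.inl hi.exists_right_inv
      · exact Or.inr ((dvd_pow_self X hpos.ne').trans hi.symm.dvd)
  · rintro ⟨⟨S, hS⟩, hdiv⟩
    have hev : P.eval 1 = 1 := by simp [hS]
    have hP : P ≠ 0 := by
      rintro rfl
      simp at hev
    obtain ⟨Q, hQ, hX⟩ := (FiniteMultiplicity.of_prime_left prime_X hP).exists_eq_pow_mul_and_not_dvd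
    rcases hdiv Q _ (hQ.trans (mul_comm _ _)) with hu | hu
    · obtain ⟨c, hc, rfl⟩ := Polynomial.isUnit_iff.1 (IsUnit.of_mul_eq_one _ hu.choose_spec)
      refine ⟨multiplicity X P, hQ.trans ?_⟩
      rw [hQ] at hev
      have : c = 1 := by simpa using hev
      rw [this, C_1, mul_one]
    · exact absurd hu hX

/-- A first-order closed family of relations on `k[X]` that contains the ring operations and the
constant `X`. -/
structure PolyClosed {k : Type*} [Field k] (D : ∀ n : ℕ, ((Fin n → k[X]) → Prop) → Prop) :
    Prop extends FOClosed D where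
  add : ∀ {n} (i j l : Fin n), D n fun x => x i = x j + x l
  mul : ∀ {n} (i j l : Fin n), D n fun x => x i = x j * x l
  X_def : D 1 fun x => x 0 = X

/-- The coding of a natural number `n` by the polynomial `X ^ n`. -/
def PowCode {k : Type*} [Field k] (P _P' : k[X]) (n : ℕ) : Prop := P = X ^ n

/-! ### Natural numbers as exponents of `X` -/

namespace PolyClosed

open FOClosed (congr)

variable {k : Type*} [Field k] {D : ∀ n : ℕ, ((Fin n → k[X]) → Prop) → Prop} (h : PolyClosed D)

include h

theorem fadd {n : ℕ} {f g : (Fin n → k[X]) → k[X]} (hf : DFun D f) (hg : DFun D g) :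
    DFun D fun x => f x + g x :=
  h.comp₂ (F := fun a b => a + b) h.add hf hg

theorem fmul {n : ℕ} {f g : (Fin n → k[X]) → k[X]} (hf : DFun D f) (hg : DFun D g) :
    DFun D fun x => f x * g x :=
  h.comp₂ (F := fun a b => a * b) h.mul hf hg

theorem fX {n : ℕ} : DFun D fun _ : Fin n → k[X] => X :=
  h.const h.X_def

theorem fone {n : ℕ} : DFun D fun _ : Fin n → k[X] => 1 :=
  h.const (congr (h.eq' h.fX (h.fmul (h.var 0) h.fX)) fun x => by
    rw [eq_comm (a := X), mul_eq_right₀ X_ne_zero])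

theorem fsub {n : ℕ} {f g : (Fin n → k[X]) → k[X]} (hf : DFun D f) (hg : DFun D g) :
    DFun D fun x => f x - g x :=
  h.comp₂ (F := fun a b => a - b) (fun i j l => congr (h.add j i l) fun x => by
    rw [eq_sub_iff_add_eq, eq_comm]) hf hg

theorem dvd {n : ℕ} {f g : (Fin n → k[X]) → k[X]} (hf : DFun D f) (hg : DFun D g) :
    D n fun x => f x ∣ g x :=
  h.app₂ (Q := fun a b => a ∣ b) (fun i j => h.ex (R := fun x a => x j = x i * a) (h.mul _ _ _))
    hf hg

theorem isCoding_powCode : IsCoding D (PowCode (k := k)) where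
  unique {P _ a b} ha hb := by
    have := congrArg natDegree (ha.symm.trans hb)
    simpa using this
  surj n := ⟨X ^ n, 0, rfl⟩
  dom {n} i _ := by
    refine congr (h.and
      (h.ex (R := fun x S => x i = (X - 1) * S + 1)
        (h.eq' (h.var _) (h.fadd (h.fmul (h.fsub h.fX h.fone) (h.var _)) h.fone)))
      (h.all (R := fun x Q => ∀ R, x i = Q * R → (∃ S, Q * S = 1) ∨ ∃ S, Q = X * S)
        (h.all (h.imp (h.mul _ _ _) (h.or
          (h.ex (h.eq' (h.fmul (h.var _) (h.var _)) h.fone))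
          (h.ex (h.eq' (h.var _) (h.fmul h.fX (h.var _)))))))))
      fun x => exists_eq_X_pow_iff (x i)

theorem foClosed_powCode : FOClosed (Coded D (PowCode (k := k))) :=
  h.coded h.isCoding_powCode <| h.coded_of h.isCoding_powCode (fun a _ => a 0 = a 1)
    (fun _ _ => h.eq _ _) fun a a' b hb => by
      rw [hb 0, hb 1]
      exact ⟨fun e => by rw [e], fun e => by simpa using congrArg natDegree e⟩

theorem add_powCode {n : ℕ} (i j l : Fin n) :
    Coded D (PowCode (k := k)) n fun x => x i = x j + x l :=
  h.coded_of h.isCoding_powCode (fun a _ => a i = a j * a l) (fun _ _ => h.mul _ _ _)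
    fun a a' b hb => by
      rw [hb i, hb j, hb l, ← pow_add]
      exact ⟨fun e => by rw [e], fun e => by simpa using congrArg natDegree e⟩

theorem dvd_powCode {n : ℕ} (i j : Fin n) :
    Coded D (PowCode (k := k)) n fun x => x i ∣ x j :=
  h.coded_of h.isCoding_powCode (fun a _ => a i - 1 ∣ a j - 1)
    (fun _ _ => h.dvd (h.fsub (h.var _) h.fone) (h.fsub (h.var _) h.fone))
    fun a a' b hb => by
      rw [hb i, hb j, X_pow_sub_one_dvd_iff]

end PolyClosed

/-- Multiplication is definable from addition and divisibility. -/
theorem ArithClosed.of_dvd {D : ∀ n : ℕ, ((Fin n → ℕ) → Prop) → Prop} (h : FOClosed D)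
    (hadd : ∀ {n} (i j l : Fin n), D n fun x => x i = x j + x l)
    (hdvd : ∀ {n} (i j : Fin n), D n fun x => x i ∣ x j) : ArithClosed D := by
  have fadd {n : ℕ} {f g : (Fin n → ℕ) → ℕ} (hf : DFun D f) (hg : DFun D g) :
      DFun D fun x => f x + g x :=
    h.comp₂ (F := fun a b => a + b) hadd hf hg
  have fone {n : ℕ} : DFun D fun _ : Fin n → ℕ => 1 :=
    h.const (FOClosed.congr (h.all (R := fun x a => x 0 ∣ a) (hdvd _ _)) fun x =>
      ⟨fun e a => by rw [e]; exact one_dvd a, fun e => Nat.dvd_one.1 (e 1)⟩)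
  -- The least common multiple is determined by its universal property for divisibility.
  have flcm {n : ℕ} {f g : (Fin n → ℕ) → ℕ} (hf : DFun D f) (hg : DFun D g) :
      DFun D fun x => Nat.lcm (f x) (g x) :=
    h.comp₂ (F := Nat.lcm) (fun i j l => FOClosed.congr
      (h.all (R := fun x m => x i ∣ m ↔ x j ∣ m ∧ x l ∣ m)
        (h.iff (hdvd _ _) (h.and (hdvd _ _) (hdvd _ _)))) fun x => by
        constructor
        · rintro e m
          rw [e, Nat.lcm_dvd_iff]
        · intro e
          refine Nat.dvd_antisymm ((e _).2 ⟨Nat.dvd_lcm_left _ _, Nat.dvd_lcm_right _ _⟩) ?_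
          exact Nat.lcm_dvd_iff.2 ((e _).1 dvd_rfl)) hf hg
  -- As `a` and `a + 1` are coprime, `a * a + a = lcm a (a + 1)`.
  have fsq {n : ℕ} {f : (Fin n → ℕ) → ℕ} (hf : DFun D f) : DFun D fun x => f x * f x :=
    h.comp₁ (F := fun a => a * a) (fun i j => FOClosed.congr
      (h.eq' (fadd (h.var i) (h.var j)) (flcm (h.var j) (fadd (h.var j) fone))) fun x => by
        rw [Nat.Coprime.lcm_eq_mul (by simp), mul_add, mul_one, add_left_inj]) hf
  refine { h with add := hadd, mul := fun i j l => ?_ }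
  -- Polarization: the product is recovered from the square of a sum.
  refine FOClosed.congr (h.eq' (fsq (fadd (h.var j) (h.var l)))
        (fadd (fadd (fsq (h.var j)) (fadd (h.var i) (h.var i))) (fsq (h.var l)))) fun x => ?_
  constructor
  · intro e
    rw [e]
    ring
  · intro e
    nlinarith

theorem PolyClosed.arithClosed {k : Type*} [Field k]
    {D : ∀ n : ℕ, ((Fin n → k[X]) → Prop) → Prop} (h : PolyClosed D) :
    ArithClosed (Coded D (PowCode (k := k))) :=
  .of_dvd h.foClosed_powCode h.add_powCode h.dvd_powCode

/-! ### Total residue maps -/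

/-- `M` is a field with a total residue map that is linear over a field of constants `ι k` and
vanishes on elements of large valuation. -/
structure IsTotalResidue {K V k : Type*} [Field K] [Zero V] [Top V] [Add V] [LT V] [Field k]
    (M : LResStructure K V k) (ι : k →+* K) : Prop where
  res_add : ∀ x y, M.res (x + y) = M.res x + M.res y
  res_smul : ∀ c x, M.res (ι c * x) = c * M.res x
  res_one : M.res 1 = 1
  mem_range : ∀ a, (∀ x, M.res (a * x) = M.res a * M.res x) → ∃ c, a = ι c
  res_mul_pow : ∀ t, 0 < M.val t → ∀ y, ∃ N, ∀ n, N ≤ n → M.res (y * t ^ n) = 0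
  res_pow : ∀ t, 0 < M.val t → ∀ n, M.res (t ^ (n + 1)) = 0
  exists_pos : ∃ t, t ≠ 0 ∧ 0 < M.val t

/-- The pair `(t, y)` codes the polynomial `∑ res (y * t ^ n) * X ^ n`. -/
def PolyCode {K V k : Type*} [Field K] [Zero V] [Top V] [Add V] [LT V] [Field k]
    (M : LResStructure K V k) (t y : K) (P : k[X]) : Prop :=
  0 < M.val t ∧ ∀ n, P.coeff n = M.res (y * t ^ n)

namespace IsTotalResidue

variable {K V k : Type*} [Field K] [Zero V] [Top V] [Add V] [LT V] [Field k]
  {M : LResStructure K V k} {ι : k →+* K} (h : IsTotalResidue M ι)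

include h

theorem res_zero : M.res 0 = 0 := by
  simpa using h.res_smul 0 0

theorem res_const (c : k) : M.res (ι c) = c := by
  simpa [h.res_one] using h.res_smul c 1

theorem const_iff (a : K) :
    (∀ x, M.res (a * x) = M.res a * M.res x) ↔ ∃ c, a = ι c := by
  refine ⟨h.mem_range a, ?_⟩
  rintro ⟨c, rfl⟩ x
  rw [h.res_smul, h.res_const]

theorem one_sub_ne_zero {t : K} (ht : 0 < M.val t) (c : k) : 1 - ι c * t ≠ 0 := by
  intro h0
  have h1 : M.res (ι c * t) = 1 := by rw [← sub_eq_zero.1 h0, h.res_one]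
  rw [h.res_smul, show t = t ^ (0 + 1) by simp, h.res_pow t ht, mul_zero] at h1
  exact zero_ne_one h1

/-- The hypothesis says `u = 1 / (1 - c * t)`; iterating it `N` times gives the truncated geometric
series with its remainder. -/
theorem res_mul_inv (t y : K) (c : k) (u : K) (hu : u = 1 + u * (ι c * t)) (N : ℕ) :
    M.res (y * u) = ∑ n ∈ Finset.range N, M.res (y * t ^ n) * c ^ n +
      c ^ N * M.res (y * u * t ^ N) := by
  induction N with
  | zero => simp
  | succ N ih =>
    have e : y * u * t ^ N = y * t ^ N + ι c * (y * u * t ^ (N + 1)) := by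
      calc y * u * t ^ N = y * (1 + u * (ι c * t)) * t ^ N := by rw [← hu]
        _ = _ := by ring
    rw [ih, e, h.res_add, h.res_smul, Finset.sum_range_succ]
    ring

/-- In the truncated geometric series the remainder has residue zero once `N` is large; taking `N`
above the degree as well makes the sum equal to `P(c)`. -/
theorem eval_eq {t y : K} {P : k[X]} (hP : PolyCode M t y P) (c : k) (u : K)
    (hu : u = 1 + u * (ι c * t)) : P.eval c = M.res (y * u) := by
  obtain ⟨N, hN⟩ := h.res_mul_pow t hP.1 (y * u)
  rw [h.res_mul_inv t y c u hu (max N (P.natDegree + 1)), hN _ (le_max_left _ _), mul_zero,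
    add_zero, eval_eq_sum_range' (n := max N (P.natDegree + 1))
      (lt_of_lt_of_le (Nat.lt_succ_self _) (le_max_right _ _))]
  exact Finset.sum_congr rfl fun n _ => by rw [hP.2]

theorem exists_polyCode {t : K} (ht : 0 < M.val t) (y : K) : ∃ P, PolyCode M t y P := by
  obtain ⟨N, hN⟩ := h.res_mul_pow t ht y
  refine ⟨∑ n ∈ Finset.range N, C (M.res (y * t ^ n)) * X ^ n, ht, fun n => ?_⟩
  simp only [finsetSum_coeff, coeff_C_mul, coeff_X_pow, mul_ite, mul_one, mul_zero,
    Finset.sum_ite_eq, Finset.mem_range]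
  split_ifs with hn
  · rfl
  · exact (hN n (not_lt.1 hn)).symm

/-- The codes are triangular: `c * t⁻ᵈ` codes a polynomial with coefficient `c` in degree `d` and
zeros above. Its lower coefficients are uncontrolled, since negative powers of `t` may have nonzero
residue, so they are subtracted and corrected by induction. -/
theorem exists_code {t : K} (ht0 : t ≠ 0) (ht : 0 < M.val t) (d : ℕ) (P : k[X])
    (hd : ∀ n, d ≤ n → P.coeff n = 0) : ∃ y, PolyCode M t y P := by
  induction d generalizing P with
  | zero =>
    exact ⟨0, ht, fun n => by rw [hd n (Nat.zero_le n), zero_mul, h.res_zero]⟩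
  | succ d ih =>
    let z := ι (P.coeff d) * (t ^ d)⁻¹
    have hz : ∀ i, M.res (z * t ^ (d + i)) = P.coeff d * M.res (t ^ i) := fun i => by
      rw [← h.res_smul]
      congr 1
      simp only [z, pow_add]
      field_simp
    obtain ⟨Q, hQ⟩ := h.exists_polyCode ht z
    obtain ⟨y, hy⟩ := ih (P - Q) fun n hn => by
      obtain ⟨i, rfl⟩ := Nat.exists_eq_add_of_le hn
      rw [coeff_sub, hQ.2, hz]
      rcases i with _ | i
      · simp [h.res_one]
      · rw [h.res_pow t ht, hd _ (by omega)]
        simp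
    refine ⟨y + z, ht, fun n => ?_⟩
    rw [add_mul, h.res_add, ← hy.2, ← hQ.2, coeff_sub, sub_add_cancel]

end IsTotalResidue

/-! ### Definability in the field sort -/

open LRes LResStructure

/-- The relations on the field sort that are definable without parameters. -/
def DefK {K V k : Type*} [Field K] [Zero V] [Top V] [Add V] [LT V] [Field k]
    (M : LResStructure K V k) (n : ℕ) (R : (Fin n → K) → Prop) : Prop :=
  ∀ σ : Fin n → ℕ, ∃ φ : LRes.Formula, ∀ e : Assignment K V k,
    M.Satisfies e φ ↔ R fun i => e.toK (σ i)

section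

variable {K V k : Type*} [Field K] [Zero V] [Top V] [Add V] [LT V] [Field k]
  (M : LResStructure K V k)

open FOClosed (congr)

theorem foClosed_defK : FOClosed (DefK M) where
  eq i j σ := ⟨.eqK (.var (σ i)) (.var (σ j)), fun _ => Iff.rfl⟩
  not hR σ := by
    obtain ⟨φ, hφ⟩ := hR σ
    exact ⟨.not φ, fun e => not_congr (hφ e)⟩
  and hR hS σ := by
    obtain ⟨φ, hφ⟩ := hR σ
    obtain ⟨ψ, hψ⟩ := hS σ
    exact ⟨.and φ ψ, fun e => and_congr (hφ e) (hψ e)⟩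
  ex {n R} hR σ := by
    obtain ⟨N, hN⟩ : ∃ N, ∀ i, σ i ≠ N :=
      ⟨∑ i, σ i + 1, fun i => by
        have := Finset.single_le_sum (f := σ) (fun _ _ => Nat.zero_le _) (Finset.mem_univ i)
        omega⟩
    obtain ⟨φ, hφ⟩ := hR (Fin.cons N σ)
    refine ⟨.exK N φ, fun e => exists_congr fun a => (hφ _).trans ?_⟩
    simp [Function.update_of_ne (hN _)]
  reindex ρ hR σ := hR fun i => σ (ρ i)

theorem defK_add {n : ℕ} (i j l : Fin n) : DefK M n fun x => x i = x j + x l :=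
  fun σ => ⟨.eqK (.var (σ i)) (.add (.var (σ j)) (.var (σ l))), fun _ => Iff.rfl⟩

theorem defK_mul {n : ℕ} (i j l : Fin n) : DefK M n fun x => x i = x j * x l :=
  fun σ => ⟨.eqK (.var (σ i)) (.mul (.var (σ j)) (.var (σ l))), fun _ => Iff.rfl⟩

theorem defK_one : DefK M 1 fun x => x 0 = 1 :=
  fun σ => ⟨.eqK (.var (σ 0)) .one, fun _ => Iff.rfl⟩

theorem defK_pos {n : ℕ} (i : Fin n) : DefK M n fun x => 0 < M.val (x i) :=
  fun σ => ⟨.ltV .zero (.val (.var (σ i))), fun _ => Iff.rfl⟩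

theorem defK_res_eq {n : ℕ} (i j : Fin n) : DefK M n fun x => M.res (x i) = M.res (x j) :=
  fun σ => ⟨.eqR (.res (.var (σ i))) (.res (.var (σ j))), fun _ => Iff.rfl⟩

theorem defK_res_add {n : ℕ} (i j l : Fin n) :
    DefK M n fun x => M.res (x i) = M.res (x j) + M.res (x l) :=
  fun σ => ⟨.eqR (.res (.var (σ i))) (.add (.res (.var (σ j))) (.res (.var (σ l)))),
    fun _ => Iff.rfl⟩

theorem defK_res_mul {n : ℕ} (i j l : Fin n) :
    DefK M n fun x => M.res (x i) = M.res (x j) * M.res (x l) :=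
  fun σ => ⟨.eqR (.res (.var (σ i))) (.mul (.res (.var (σ j))) (.res (.var (σ l)))),
    fun _ => Iff.rfl⟩

theorem fadd_defK {n : ℕ} {f g : (Fin n → K) → K} (hf : DFun (DefK M) f)
    (hg : DFun (DefK M) g) : DFun (DefK M) fun x => f x + g x :=
  (foClosed_defK M).comp₂ (F := fun a b => a + b) (defK_add M) hf hg

theorem fmul_defK {n : ℕ} {f g : (Fin n → K) → K} (hf : DFun (DefK M) f)
    (hg : DFun (DefK M) g) : DFun (DefK M) fun x => f x * g x :=
  (foClosed_defK M).comp₂ (F := fun a b => a * b) (defK_mul M) hf hg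

/-- The element `a` is a constant. -/
def IsConst (a : K) : Prop := ∀ x, M.res (a * x) = M.res a * M.res x

theorem defK_isConst {n : ℕ} (i : Fin n) : DefK M n fun x => IsConst M (x i) :=
  have h := foClosed_defK M
  h.all (R := fun x b => M.res (x i * b) = M.res (x i) * M.res b)
    (h.app₃ (Q := fun a b c => M.res a = M.res b * M.res c) (defK_res_mul M)
      (fmul_defK M (h.var _) (h.var _)) (h.var _) (h.var _))

/-- The residue of `w` is the value at the residue of `c` of the polynomial coded by `(t, y)`. -/
def IsValue (t y c w : K) : Prop := ∃ u, u = 1 + u * (c * t) ∧ M.res w = M.res (y * u)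

theorem defK_isValue {n : ℕ} (i j l m : Fin n) :
    DefK M n fun x => IsValue M (x i) (x j) (x l) (x m) :=
  have h := foClosed_defK M
  h.ex (R := fun x u => u = 1 + u * (x l * x i) ∧ M.res (x m) = M.res (x j * u))
    (h.and (h.eq' (h.var _) (fadd_defK M (h.const (defK_one M))
        (fmul_defK M (h.var _) (fmul_defK M (h.var _) (h.var _)))))
      (h.app₂ (Q := fun a b => M.res a = M.res b) (defK_res_eq M) (h.var _)
        (fmul_defK M (h.var _) (h.var _))))

end

/-! ### The polynomial ring `k[X]` inside `M` -/

namespace IsTotalResidue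

variable {K V k : Type*} [Field K] [Zero V] [Top V] [Add V] [LT V] [Field k]
  {M : LResStructure K V k} {ι : k →+* K} (h : IsTotalResidue M ι)

include h

open FOClosed (congr)

theorem isConst_iff (a : K) : IsConst M a ↔ ∃ c, a = ι c := h.const_iff a

/-- The element `1 - c * t` is nonzero, so its inverse supplies the required `u`. -/
theorem isValue_iff {t y : K} {P : k[X]} (hP : PolyCode M t y P) (c : k) (w : K) :
    IsValue M t y (ι c) w ↔ M.res w = P.eval c := by
  constructor
  · rintro ⟨u, hu, hw⟩
    rw [hw, h.eval_eq hP c u hu]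
  · intro hw
    have hne := h.one_sub_ne_zero hP.1 c
    have hu : (1 - ι c * t)⁻¹ = 1 + (1 - ι c * t)⁻¹ * (ι c * t) := by
      field_simp
      ring
    exact ⟨_, hu, by rw [hw, h.eval_eq hP c _ hu]⟩

theorem isCoding_polyCode : IsCoding (DefK M) (PolyCode M) where
  unique ha hb := by
    ext n
    rw [ha.2, hb.2]
  surj P := by
    obtain ⟨t, ht0, ht⟩ := h.exists_pos
    obtain ⟨y, hy⟩ := h.exists_code ht0 ht (P.natDegree + 1) P fun n hn =>
      coeff_eq_zero_of_natDegree_lt (by omega)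
    exact ⟨t, y, hy⟩
  dom i j := congr (defK_pos M i) fun x =>
    ⟨fun ⟨_, hP⟩ => hP.1, fun ht => h.exists_polyCode ht _⟩

variable [Infinite k]

/-- A relation between three polynomials that can be checked on values is definable. -/
theorem coded_of_values {F : k[X] → k[X] → k[X]} {G : k → k → k}
    (hFG : ∀ P Q c, (F P Q).eval c = G (P.eval c) (Q.eval c))
    (hG : ∀ {n} (i j l : Fin n),
      DefK M n fun x => M.res (x i) = G (M.res (x j)) (M.res (x l)))
    {n : ℕ} (i j l : Fin n) :
    Coded (DefK M) (PolyCode M) n fun x => x i = F (x j) (x l) := by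
  have hK := foClosed_defK M
  -- Values in `k` are represented by elements of `K` with the given residue, so that all
  -- quantifiers stay in the field sort.
  refine hK.coded_of h.isCoding_polyCode (fun t y => ∀ c, IsConst M c → ∀ a, ∀ b, ∀ d,
    IsValue M (t i) (y i) c a → IsValue M (t j) (y j) c b → IsValue M (t l) (y l) c d →
      M.res a = G (M.res b) (M.res d)) (fun σ τ => ?_) fun t y P hP => ?_
  · exact hK.all (hK.imp (defK_isConst M _) (hK.all (hK.all (hK.all
      (hK.imp (defK_isValue M _ _ _ _) (hK.imp (defK_isValue M _ _ _ _)
        (hK.imp (defK_isValue M _ _ _ _) (hG _ _ _))))))))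
  · constructor
    · rintro hx c hc a b d ha hb hd
      obtain ⟨c, rfl⟩ := (h.isConst_iff c).1 hc
      rw [(h.isValue_iff (hP i) c a).1 ha, (h.isValue_iff (hP j) c b).1 hb,
        (h.isValue_iff (hP l) c d).1 hd, ← hFG, ← hx]
    · intro hx
      -- Here the infinitude of `k` enters: equal values everywhere imply equal polynomials.
      refine Polynomial.funext fun c => ?_
      have := hx (ι c) ((h.isConst_iff _).2 ⟨c, rfl⟩) (ι ((P i).eval c)) (ι ((P j).eval c))
        (ι ((P l).eval c)) ((h.isValue_iff (hP i) c _).2 (h.res_const _))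
        ((h.isValue_iff (hP j) c _).2 (h.res_const _))
        ((h.isValue_iff (hP l) c _).2 (h.res_const _))
      rw [h.res_const, h.res_const, h.res_const] at this
      rw [this, hFG]

theorem polyClosed : PolyClosed (Coded (DefK M) (PolyCode M)) := by
  have hK := foClosed_defK M
  -- Equality of coded polynomials is the case in which the operation is the first projection.
  have hfst : ∀ {n : ℕ} (i j l : Fin n),
      Coded (DefK M) (PolyCode M) n fun x => x i = (fun P _ => P) (x j) (x l) :=
    h.coded_of_values (G := fun a _ => a) (fun _ _ _ => rfl) fun i j _ => defK_res_eq M i j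
  have hX : Coded (DefK M) (PolyCode M) 1 fun x => x 0 = X := by
    refine hK.coded_of h.isCoding_polyCode
      -- `X` is the polynomial whose value at every `c` is `c`.
      (fun t y => ∀ c, IsConst M c → IsValue M (t 0) (y 0) c c) (fun σ τ => ?_)
      fun t y P hP => ?_
    · exact hK.all (hK.imp (defK_isConst M _) (defK_isValue M _ _ _ _))
    · constructor
      · intro hx c hc
        obtain ⟨c, rfl⟩ := (h.isConst_iff c).1 hc
        rw [h.isValue_iff (hP 0), h.res_const, hx, eval_X]
      · intro hx
        refine Polynomial.funext fun c => ?_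
        have := hx (ι c) ((h.isConst_iff _).2 ⟨c, rfl⟩)
        rw [h.isValue_iff (hP 0), h.res_const] at this
        rw [← this, eval_X]
  exact { hK.coded h.isCoding_polyCode (hfst 0 1 1) with
    add := h.coded_of_values (F := fun P Q => P + Q) (G := fun a b => a + b)
      (fun _ _ _ => eval_add) (defK_res_add M)
    mul := h.coded_of_values (F := fun P Q => P * Q) (G := fun a b => a * b)
      (fun _ _ _ => eval_mul) (defK_res_mul M)
    X_def := hX }

end IsTotalResidue

/-! ### The interpretation of arithmetic -/

/-- The pair `(t, y)` codes the natural number `n`, that is, the polynomial `X ^ n`. -/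
def NatCode {K V k : Type*} [Field K] [Zero V] [Top V] [Add V] [LT V] [Field k]
    (M : LResStructure K V k) (t y : K) (n : ℕ) : Prop :=
  PolyCode M t y (X ^ n)

/-- The family of those relations on `ℕ` that are definable in terms of codes. -/
def DefN {K V k : Type*} [Field K] [Zero V] [Top V] [Add V] [LT V] [Field k]
    (M : LResStructure K V k) : ∀ n : ℕ, ((Fin n → ℕ) → Prop) → Prop :=
  Coded (Coded (DefK M) (PolyCode M)) (PowCode (k := k))

theorem DefN.exists_formula {K V k : Type*} [Field K] [Zero V] [Top V] [Add V] [LT V] [Field k]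
    {M : LResStructure K V k} {n : ℕ} {R : (Fin n → ℕ) → Prop} (hR : DefN M n R) (σ τ : Fin n → ℕ) :
    ∃ φ : LRes.Formula, ∀ e : Assignment K V k, M.Satisfies e φ ↔
      ∃ b : Fin n → ℕ, (∀ i, NatCode M (e.toK (σ i)) (e.toK (τ i)) (b i)) ∧ R b := by
  -- The first `n` field variables carry the components `t` of the codes, the last `n` the
  -- components `y`.
  obtain ⟨φ, hφ⟩ := hR n id id (n + n) (Fin.castAdd n) (Fin.natAdd n) (Fin.append σ τ)
  refine ⟨φ, fun e => (hφ e).trans ?_⟩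
  simp only [Fin.append_left, Fin.append_right, id]
  constructor
  · rintro ⟨P, hP, b, hb, hR⟩
    refine ⟨b, fun i => ?_, hR⟩
    have := hP i
    rwa [hb i] at this
  · rintro ⟨b, hb, hR⟩
    exact ⟨fun i => X ^ b i, hb, b, fun i => rfl, hR⟩

namespace IsTotalResidue

variable {K V k : Type*} [Field K] [Zero V] [Top V] [Add V] [LT V] [Field k]
  {M : LResStructure K V k} {ι : k →+* K} (h : IsTotalResidue M ι)

include h

theorem natCode_unique {t y : K} {n m : ℕ} (hn : NatCode M t y n) (hm : NatCode M t y m) :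
    n = m := by
  have := congrArg natDegree (h.isCoding_polyCode.unique hn hm)
  simpa using this

theorem exists_natCode (n : ℕ) : ∃ t y, NatCode M t y n :=
  h.isCoding_polyCode.surj _

theorem interprets (hA : ArithClosed (DefN M)) : M.Interprets arithLanguage ℕ := by
  let X : Set (Tuple K V k 2 0 0) := {u | ∃ n, NatCode M (u.1 0) (u.1 1) n}
  let f : X → ℕ := fun u => u.2.choose
  have hf : ∀ u : X, NatCode M (u.1.1 0) (u.1.1 1) (f u) := fun u => u.2.choose_spec
  have key : ∀ {n : ℕ} {R : (Fin n → ℕ) → Prop}, DefN M n R →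
      M.Definable {x : Fin n → Tuple K V k 2 0 0 |
        ∃ h : ∀ j, x j ∈ X, R fun j => f ⟨x j, h j⟩} := by
    intro n R hR
    obtain ⟨φ, hφ⟩ := DefN.exists_formula hR (fun j => Nat.pair j 0) fun j => Nat.pair j 1
    refine ⟨φ, fun e => (hφ e).trans ?_⟩
    constructor
    · rintro ⟨b, hb, hR⟩
      refine ⟨fun j => ⟨b j, hb j⟩, ?_⟩
      convert hR using 2 with j
      exact h.natCode_unique (hf _) (hb j)
    · rintro ⟨hx, hR⟩
      exact ⟨_, fun j => hf ⟨_, hx j⟩, hR⟩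
  refine ⟨2, 0, 0, X, f, fun n => ?_, ?_, ?_, fun n F => ?_, fun n R => nomatch R⟩
  · obtain ⟨t, y, hn⟩ := h.exists_natCode n
    let u : X := ⟨(![t, y], ![], ![]), n, hn⟩
    exact ⟨u, h.natCode_unique (hf u) hn⟩
  · obtain ⟨φ, hφ⟩ := key hA.true (n := 1)
    refine ⟨φ, fun e => (hφ e).trans ?_⟩
    constructor
    · rintro ⟨hx, -⟩
      exact hx 0
    · intro hx
      refine ⟨fun j => ?_, trivial⟩
      rw [Subsingleton.elim j 0]
      exact hx
  · exact key (hA.eq 0 1)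
  · refine key (R := fun b => FirstOrder.Language.Structure.funMap F
      (fun j : Fin n => b j.castSucc) = b (Fin.last n)) ?_
    cases F with
    | add => exact FOClosed.congr (hA.add 2 0 1) fun x => eq_comm
    | mul => exact FOClosed.congr (hA.mul 2 0 1) fun x => eq_comm

end IsTotalResidue

/-! ### Undecidability -/

namespace LRes.Formula

/-- All free variables of the formula have names below `B`. -/
def VarsBelow (B : ℕ) (φ : Formula) : Prop := ∀ p ∈ φ.freeVars, p.2 < B

theorem _root_.LRes.TermK.exists_bound (s : TermK) : ∃ B, ∀ p ∈ s.vars, p.2 < B := by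
  induction s with
  | var n => exact ⟨n + 1, by simp [TermK.vars]⟩
  | zero | one => exact ⟨0, by simp [TermK.vars]⟩
  | neg s ih => exact ih
  | add s t hs ht | mul s t hs ht =>
    obtain ⟨B, hB⟩ := hs
    obtain ⟨B', hB'⟩ := ht
    refine ⟨max B B', fun p hp => ?_⟩
    rcases hp with hp | hp
    · exact lt_max_of_lt_left (hB p hp)
    · exact lt_max_of_lt_right (hB' p hp)

theorem _root_.LRes.TermV.exists_bound (s : TermV) : ∃ B, ∀ p ∈ s.vars, p.2 < B := by
  induction s with
  | var n => exact ⟨n + 1, by simp [TermV.vars]⟩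
  | zero | infty => exact ⟨0, by simp [TermV.vars]⟩
  | val s => exact s.exists_bound
  | add s t hs ht =>
    obtain ⟨B, hB⟩ := hs
    obtain ⟨B', hB'⟩ := ht
    refine ⟨max B B', fun p hp => ?_⟩
    rcases hp with hp | hp
    · exact lt_max_of_lt_left (hB p hp)
    · exact lt_max_of_lt_right (hB' p hp)

theorem _root_.LRes.TermR.exists_bound (s : TermR) : ∃ B, ∀ p ∈ s.vars, p.2 < B := by
  induction s with
  | var n => exact ⟨n + 1, by simp [TermR.vars]⟩
  | zero | one => exact ⟨0, by simp [TermR.vars]⟩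
  | neg s ih => exact ih
  | res s => exact s.exists_bound
  | add s t hs ht | mul s t hs ht =>
    obtain ⟨B, hB⟩ := hs
    obtain ⟨B', hB'⟩ := ht
    refine ⟨max B B', fun p hp => ?_⟩
    rcases hp with hp | hp
    · exact lt_max_of_lt_left (hB p hp)
    · exact lt_max_of_lt_right (hB' p hp)

theorem exists_varsBelow (φ : Formula) : ∃ B, φ.VarsBelow B := by
  have union : ∀ {S T : Set (Srt × ℕ)}, (∃ B, ∀ p ∈ S, p.2 < B) → (∃ B, ∀ p ∈ T, p.2 < B) →
      ∃ B, ∀ p ∈ S ∪ T, p.2 < B := by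
    rintro S T ⟨B, hB⟩ ⟨B', hB'⟩
    refine ⟨max B B', fun p hp => ?_⟩
    rcases hp with hp | hp
    · exact lt_max_of_lt_left (hB p hp)
    · exact lt_max_of_lt_right (hB' p hp)
  induction φ with
  | eqK s t | eqV s t | eqR s t | ltV s t => exact union s.exists_bound t.exists_bound
  | not φ ih => exact ih
  | and φ ψ hφ hψ => exact union hφ hψ
  | exK n φ ih | exV n φ ih | exR n φ ih =>
    obtain ⟨B, hB⟩ := ih
    exact ⟨B, fun p hp => hB p hp.1⟩

theorem VarsBelow.mono {B B' : ℕ} {φ : Formula} (h : φ.VarsBelow B) (hB : B ≤ B') :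
    φ.VarsBelow B' := fun p hp => (h p hp).trans_le hB

theorem VarsBelow.and {B : ℕ} {φ ψ : Formula} (h : φ.VarsBelow B) (h' : ψ.VarsBelow B) :
    (Formula.and φ ψ).VarsBelow B := fun p hp => hp.elim (h p) (h' p)

theorem VarsBelow.exK {B : ℕ} {φ : Formula} (h : φ.VarsBelow B) (n : ℕ) :
    (Formula.exK n φ).VarsBelow B := fun p hp => h p hp.1

/-- Existential closure with respect to all variables with names below `B`. -/
def close (φ : Formula) : ℕ → Formula
  | 0 => φ
  | B + 1 => .exK B (.exV B (.exR B (close φ B)))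

theorem close_freeVars (φ : Formula) (B : ℕ) (p : Srt × ℕ) (hp : p ∈ (φ.close B).freeVars) :
    p ∈ φ.freeVars ∧ B ≤ p.2 := by
  induction B with
  | zero => exact ⟨hp, Nat.zero_le _⟩
  | succ B ih =>
    obtain ⟨⟨⟨hp, hR⟩, hV⟩, hK⟩ := hp
    obtain ⟨h1, h2⟩ := ih hp
    refine ⟨h1, Nat.lt_of_le_of_ne h2 ?_⟩
    rintro rfl
    rcases p with ⟨_ | _ | _, n⟩
    · exact hK rfl
    · exact hV rfl
    · exact hR rfl

theorem isSentence_close {φ : Formula} {B : ℕ} (h : φ.VarsBelow B) : (φ.close B).IsSentence :=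
  Set.eq_empty_of_forall_notMem fun p hp =>
    absurd (h p (close_freeVars φ B p hp).1) (not_lt.2 (close_freeVars φ B p hp).2)

/-- The truth of `φ` does not depend on the assignment, and the sorts are nonempty, so the added
quantifiers are vacuous. -/
theorem satisfies_close {K V k : Type*} [Ring K] [Zero V] [Top V] [Add V] [LT V] [Ring k]
    (M : LResStructure K V k) {φ : Formula} {p : Prop} (h : ∀ e, M.Satisfies e φ ↔ p) (B : ℕ)
    (e : Assignment K V k) : M.Satisfies e (φ.close B) ↔ p := by
  induction B generalizing e with
  | zero => exact h e
  | succ B ih =>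
    simp only [close, LResStructure.Satisfies, ih, exists_const]

theorem primrec_code_close {F : ℕ → Formula} (hF : Primrec fun n => (F n).code) (B : ℕ) :
    Primrec fun n => ((F n).close B).code := by
  induction B with
  | zero => exact hF
  | succ B ih =>
    simp only [close, Formula.code]
    have hp : ∀ (c : ℕ) {u : ℕ → ℕ}, Primrec u → Primrec fun n => Nat.pair c (u n) :=
      fun c _ hu => Primrec₂.natPair.comp (Primrec.const c) hu
    exact hp _ (hp _ (hp _ (hp _ (hp _ (hp _ ih)))))

/-- If `succ` defines the graph of the successor on codes and `eq` the equality of codes, then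
this expresses that `φ` holds for the `n`-th successor of the element coded by the variables
`0` and `1`. -/
def shift (succ eq φ : Formula) : ℕ → Formula
  | 0 => φ
  | n + 1 => .exK 2 (.exK 3 (.and succ (.exK 0 (.exK 1 (.and eq (shift succ eq φ n))))))

/-- Every step puts the previous formula into one fixed context. Copying the successor from the
variables `2`, `3` back to `0`, `1` avoids any substitution, so the codes obey a simple primitive
recursion. -/
theorem primrec_code_shift (succ eq φ : Formula) :
    Primrec fun n => (shift succ eq φ n).code := by
  have hp : ∀ (c : ℕ) {u : ℕ → ℕ}, Primrec u → Primrec fun n => Nat.pair c (u n) :=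
    fun c _ hu => Primrec₂.natPair.comp (Primrec.const c) hu
  have hstep : Primrec fun m : ℕ => Nat.pair 6 (Nat.pair 2 (Nat.pair 6 (Nat.pair 3
      (Nat.pair 5 (Nat.pair succ.code (Nat.pair 6 (Nat.pair 0 (Nat.pair 6 (Nat.pair 1
        (Nat.pair 5 (Nat.pair eq.code m))))))))))) :=
    hp _ (hp _ (hp _ (hp _ (hp _ (hp _ (hp _ (hp _ (hp _ (hp _ (hp _ (hp _ .id)))))))))))
  refine (Primrec.nat_rec₁ φ.code (hstep.comp Primrec.snd).to₂).of_eq fun n => ?_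
  induction n with
  | zero => rfl
  | succ n ih => simp only [shift, Formula.code, ← ih]

theorem varsBelow_shift {B : ℕ} {succ eq φ : Formula} (hs : succ.VarsBelow B)
    (he : eq.VarsBelow B) (hφ : φ.VarsBelow B) (n : ℕ) : (shift succ eq φ n).VarsBelow B := by
  induction n with
  | zero => exact hφ
  | succ n ih => exact ((hs.and (((he.and ih).exK 1).exK 0)).exK 3).exK 2

end LRes.Formula

/-! ### Reduction of the halting problem -/

namespace IsTotalResidue

variable {K V k : Type*} [Field K] [Zero V] [Top V] [Add V] [LT V] [Field k]
  {M : LResStructure K V k} {ι : k →+* K} (h : IsTotalResidue M ι)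

include h

/-- If `φ` expresses the property `R` of the number coded by the variables `0` and `1`, then its
`n`-th shift expresses the property `R (· + n)`. -/
theorem satisfies_shift {succ eq φ : LRes.Formula} {R : ℕ → Prop}
    (hs : ∀ e : Assignment K V k, M.Satisfies e succ ↔
      ∃ a, NatCode M (e.toK 0) (e.toK 1) a ∧ NatCode M (e.toK 2) (e.toK 3) (a + 1))
    (he : ∀ e : Assignment K V k, M.Satisfies e eq ↔
      ∃ a, NatCode M (e.toK 0) (e.toK 1) a ∧ NatCode M (e.toK 2) (e.toK 3) a)
    (hφ : ∀ e : Assignment K V k, M.Satisfies e φ ↔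
      ∃ a, NatCode M (e.toK 0) (e.toK 1) a ∧ R a) (n : ℕ) (e : Assignment K V k) :
    M.Satisfies e (LRes.Formula.shift succ eq φ n) ↔
      ∃ a, NatCode M (e.toK 0) (e.toK 1) a ∧ R (a + n) := by
  induction n generalizing e with
  | zero => exact hφ e
  | succ n ih =>
    simp only [LRes.Formula.shift, LResStructure.Satisfies, ih, hs, he]
    simp only [Function.update_apply, OfNat.zero_ne_ofNat,
      OfNat.one_ne_ofNat, OfNat.ofNat_ne_zero, OfNat.ofNat_ne_one, zero_ne_one, one_ne_zero,
      reduceIte, Nat.reduceEqDiff]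
    constructor
    · rintro ⟨t, y, ⟨a, ha, ha'⟩, t', y', ⟨b, hb, hb'⟩, c, hc, hR⟩
      obtain rfl := h.natCode_unique hb hc
      obtain rfl := h.natCode_unique hb' ha'
      exact ⟨a, ha, by rwa [add_right_comm] at hR⟩
    · rintro ⟨a, ha, hR⟩
      obtain ⟨t, y, ht⟩ := h.exists_natCode (a + 1)
      exact ⟨t, y, ⟨a, ha, ht⟩, t, y, ⟨_, ht, ht⟩, _, ht, by rwa [add_right_comm]⟩

theorem undecidable (hA : ArithClosed (DefN M)) : M.Undecidable := by
  intro hc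
  obtain ⟨H, hH, hdef⟩ := exists_arith_not_computable
  obtain ⟨φ, hφ⟩ := DefN.exists_formula (hdef _ hA) ![0] ![1]
  obtain ⟨ζ, hζ⟩ := DefN.exists_formula (hA.eq' (hA.var (0 : Fin 1)) hA.fzero) ![0] ![1]
  obtain ⟨ε, hε⟩ := DefN.exists_formula (hA.eq (0 : Fin 2) 1) ![0, 2] ![1, 3]
  obtain ⟨σ, hσ⟩ := DefN.exists_formula
    (hA.eq' (hA.var (1 : Fin 2)) (hA.fadd (hA.var 0) hA.fone)) ![0, 2] ![1, 3]
  have hshift := h.satisfies_shift (succ := σ) (eq := ε) (φ := φ) (R := H)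
    (fun e => by
      rw [hσ]
      constructor
      · rintro ⟨b, hb, e1⟩
        exact ⟨b 0, hb 0, e1 ▸ hb 1⟩
      · rintro ⟨a, ha, ha'⟩
        exact ⟨![a, a + 1], Fin.forall_fin_two.2 ⟨ha, ha'⟩, rfl⟩)
    (fun e => by
      rw [hε]
      constructor
      · rintro ⟨b, hb, e1⟩
        exact ⟨b 0, hb 0, e1 ▸ hb 1⟩
      · rintro ⟨a, ha, ha'⟩
        exact ⟨![a, a], Fin.forall_fin_two.2 ⟨ha, ha'⟩, rfl⟩)
    (fun e => by
      rw [hφ]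
      constructor
      · rintro ⟨b, hb, e1⟩
        exact ⟨b 0, hb 0, e1⟩
      · rintro ⟨a, ha, ha'⟩
        exact ⟨![a], Fin.forall_fin_one.2 ha, ha'⟩)
  -- Starting from a code of zero, the `n`-th shift tests `H` at `0 + n`, so `F n` expresses `H n`.
  let F : ℕ → LRes.Formula := fun n => .exK 0 (.exK 1 (.and ζ (.shift σ ε φ n)))
  have hF : ∀ n (e : Assignment K V k), M.Satisfies e (F n) ↔ H n := by
    intro n e
    simp only [F, LResStructure.Satisfies, hshift, hζ]
    constructor
    · rintro ⟨t, y, ⟨b, hb, hb0⟩, a, ha, hR⟩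
      have : b 0 = a := h.natCode_unique (hb 0) ha
      rwa [← this, hb0, zero_add] at hR
    · intro hn
      obtain ⟨t, y, hty⟩ := h.exists_natCode 0
      exact ⟨t, y, ⟨![0], Fin.forall_fin_one.2 hty, rfl⟩, 0, hty, by rwa [zero_add]⟩
  obtain ⟨B₁, hB₁⟩ := φ.exists_varsBelow
  obtain ⟨B₂, hB₂⟩ := ζ.exists_varsBelow
  obtain ⟨B₃, hB₃⟩ := ε.exists_varsBelow
  obtain ⟨B₄, hB₄⟩ := σ.exists_varsBelow
  -- The bound on variable names is independent of `n`, so a fixed number of quantifiers closes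
  -- every `F n`.
  let B := B₁ + B₂ + B₃ + B₄
  have hFB : ∀ n, (F n).VarsBelow B := fun n =>
    (((hB₂.mono (by omega)).and (LRes.Formula.varsBelow_shift (hB₄.mono (by omega))
      (hB₃.mono (by omega)) (hB₁.mono (by omega)) n)).exK 1).exK 0
  have hcode : Primrec fun n => ((F n).close B).code := by
    refine LRes.Formula.primrec_code_close ?_ B
    simp only [F, LRes.Formula.code]
    have hp : ∀ (c : ℕ) {u : ℕ → ℕ}, Primrec u → Primrec fun n => Nat.pair c (u n) :=
      fun c _ hu => Primrec₂.natPair.comp (Primrec.const c) hu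
    exact hp _ (hp _ (hp _ (hp _ (hp _ (hp _ (LRes.Formula.primrec_code_shift σ ε φ))))))
  refine hH ((ComputablePred.computable_of_manyOneReducible
    (ManyOneReducible.mk _ hcode.to_comp) hc).of_eq fun n => ?_)
  constructor
  · rintro ⟨ψ, hψ, -, hsat⟩
    rw [LRes.Formula.code_injective hψ] at hsat
    exact (LRes.Formula.satisfies_close M (hF n) B ⟨fun _ => 0, fun _ => 0, fun _ => 0⟩).1
      (hsat _)
  · intro hn
    exact ⟨_, rfl, LRes.Formula.isSentence_close (hFB n), fun e =>
      (LRes.Formula.satisfies_close M (hF n) B e).2 hn⟩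

end IsTotalResidue

/-! ### Hahn series and Puiseux series -/

/-- The elements bounded in absolute value by a multiple of `g > 0` form a nonzero convex subgroup,
hence the whole group. -/
theorem IsRankOne.archimedean {Γ : Type*} [AddCommGroup Γ] [LinearOrder Γ]
    [IsOrderedAddMonoid Γ] (h : IsRankOne Γ) : Archimedean Γ where
  arch x g hg := by
    let H : AddSubgroup Γ :=
      { carrier := {x | ∃ n : ℕ, |x| ≤ n • g}
        zero_mem' := ⟨0, by simp⟩
        add_mem' := by
          rintro a b ⟨n, hn⟩ ⟨m, hm⟩
          exact ⟨n + m, (abs_add_le a b).trans (by rw [add_nsmul]; exact add_le_add hn hm)⟩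
        neg_mem' := by
          rintro a ⟨n, hn⟩
          exact ⟨n, by rwa [abs_neg]⟩ }
    have hH : (H : Set Γ).OrdConnected := by
      refine ⟨?_⟩
      rintro a ⟨n, hn⟩ b ⟨m, hm⟩ c ⟨hac, hcb⟩
      refine ⟨n + m, abs_le.2 ⟨?_, ?_⟩⟩
      · refine le_trans ?_ ((abs_le.1 hn).1.trans hac)
        exact neg_le_neg (nsmul_le_nsmul_left hg.le (Nat.le_add_right n m))
      · refine (hcb.trans (abs_le.1 hm).2).trans ?_
        exact nsmul_le_nsmul_left hg.le (Nat.le_add_left m n)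
    have hgH : g ∈ H := ⟨1, by rw [one_nsmul, abs_of_pos hg]⟩
    rcases h.2 H hH with hbot | htop
    · rw [hbot, AddSubgroup.mem_bot] at hgH
      exact absurd hgH hg.ne'
    · obtain ⟨n, hn⟩ : x ∈ H := htop ▸ AddSubgroup.mem_top x
      exact ⟨n, (le_abs_self x).trans hn⟩

section

variable {k : Type*} [Field k] {Γ : Type*} [AddCommGroup Γ] [LinearOrder Γ]
  [IsOrderedAddMonoid Γ]

theorem coeff_zero_of_addVal_pos {x : HahnSeries Γ k} (hx : 0 < HahnSeries.addVal Γ k x) :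
    x.coeff 0 = 0 := by
  by_contra h0
  exact absurd (HahnSeries.addVal_le_of_coeff_ne_zero h0) (not_le.2 hx)

theorem exists_forall_add_nsmul_pos [Archimedean Γ] (a g : WithTop Γ) (hg : 0 < g) :
    ∃ N : ℕ, ∀ n, N ≤ n → 0 < a + n • g := by
  induction a with
  | top => exact ⟨0, fun n _ => by simp⟩
  | coe a =>
    induction g with
    | top =>
      -- The exponent `0` is excluded because `0 • ⊤ = 0`.
      refine ⟨1, fun n hn => ?_⟩
      obtain ⟨m, rfl⟩ := Nat.exists_eq_add_of_le' hn
      simp [succ_nsmul]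
    | coe g =>
      have hg' : 0 < g := WithTop.coe_pos.1 hg
      obtain ⟨N, hN⟩ := Archimedean.arch (-a) hg'
      refine ⟨N + 1, fun n hn => ?_⟩
      rw [← WithTop.coe_nsmul, ← WithTop.coe_add, WithTop.coe_pos, ← neg_lt_iff_pos_add']
      exact hN.trans_lt (nsmul_lt_nsmul_left hg' hn)

/-- A field of Hahn series that contains all monomials carries a total residue map. -/
theorem isTotalResidue_of_embedding [Archimedean Γ] [Nontrivial Γ] {K : Type*} [Field K]
    (M : LResStructure K (WithTop Γ) k) (ι : k →+* K) (j : K →+* HahnSeries Γ k)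
    (hι : ∀ c, j (ι c) = HahnSeries.C c) (hval : ∀ x, M.val x = HahnSeries.addVal Γ k (j x))
    (hres : ∀ x, M.res x = (j x).coeff 0)
    (hj : ∀ q, ∃ x, j x = HahnSeries.single q 1) : IsTotalResidue M ι where
  res_add x y := by rw [hres, hres, hres, map_add, HahnSeries.coeff_add]
  res_smul c x := by
    rw [hres, hres, map_mul, hι, HahnSeries.C_mul_eq_smul, HahnSeries.coeff_smul, smul_eq_mul]
  res_one := by rw [hres, map_one, HahnSeries.coeff_one, if_pos rfl]
  mem_range a ha := by
    refine ⟨M.res a, j.injective ?_⟩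
    ext q
    rw [hι, HahnSeries.C_apply, hres]
    -- Multiplication by the monomial of exponent `-q` moves the coefficient of `a` at `q` to
    -- position `0`. For `q ≠ 0` this monomial has residue zero, so the coefficient vanishes.
    obtain ⟨x, hx⟩ := hj (-q)
    have hq := ha x
    rw [hres, hres, hres, map_mul, hx, HahnSeries.coeff_mul_single, zero_sub, neg_neg,
      mul_one] at hq
    rw [hq]
    by_cases h0 : q = 0
    · subst h0
      simp
    · rw [HahnSeries.coeff_single_of_ne h0,
        HahnSeries.coeff_single_of_ne (by simpa using h0), mul_zero]
  res_mul_pow t ht y := by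
    rw [hval] at ht
    obtain ⟨N, hN⟩ := exists_forall_add_nsmul_pos (HahnSeries.addVal Γ k (j y)) _ ht
    refine ⟨N, fun n hn => ?_⟩
    rw [hres, map_mul, map_pow]
    refine coeff_zero_of_addVal_pos ?_
    rw [AddValuation.map_mul, AddValuation.map_pow]
    exact hN n hn
  res_pow t ht n := by
    rw [hval] at ht
    rw [hres, map_pow]
    refine coeff_zero_of_addVal_pos ?_
    rw [AddValuation.map_pow, succ_nsmul]
    exact ht.trans_le (le_add_of_nonneg_left (nsmul_nonneg ht.le n))
  exists_pos := by
    obtain ⟨g, hg⟩ := exists_gt (0 : Γ)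
    obtain ⟨x, hx⟩ := hj g
    refine ⟨x, ?_, ?_⟩
    · rintro rfl
      rw [map_zero] at hx
      exact HahnSeries.single_ne_zero one_ne_zero hx.symm
    · rw [hval, hx, HahnSeries.addVal_apply, HahnSeries.orderTop_single one_ne_zero]
      exact WithTop.coe_pos.2 hg

end

theorem C_mem_puiseux {k : Type*} [Field k] (c : k) :
    (HahnSeries.C c : HahnSeries ℚ k) ∈ puiseux k :=
  Set.mem_iUnion.2 ⟨1, HahnSeries.C c, HahnSeries.embDomainRingHom_C⟩

theorem single_mem_puiseux {k : Type*} [Field k] (q : ℚ) :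
    (HahnSeries.single q 1 : HahnSeries ℚ k) ∈ puiseux k := by
  -- The denominator of `q` selects the root of `t`, and the numerator is the exponent of that root.
  refine Set.mem_iUnion.2 ⟨⟨q.den, q.pos⟩, HahnSeries.single q.num 1, ?_⟩
  refine HahnSeries.embDomain_single.trans ?_
  congr 2
  exact q.num_div_den

theorem isTotalResidue_hahnRes (k : Type*) [Field k] {Γ : Type*} [AddCommGroup Γ]
    [LinearOrder Γ] [IsOrderedAddMonoid Γ] (h : IsRankOne Γ) :
    IsTotalResidue (hahnRes k Γ) HahnSeries.C :=
  have := h.archimedean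
  have := h.1
  isTotalResidue_of_embedding (hahnRes k Γ) HahnSeries.C (RingHom.id _) (fun _ => rfl)
    (fun _ => rfl) (fun _ => rfl) fun q => ⟨HahnSeries.single q 1, rfl⟩

theorem isTotalResidue_puiseuxRes (k : Type*) [Field k] :
    IsTotalResidue (puiseuxRes k) (HahnSeries.C.codRestrict (puiseux k) C_mem_puiseux) :=
  isTotalResidue_of_embedding (puiseuxRes k) _ (puiseux k).subtype (fun _ => rfl)
    (fun _ => rfl) (fun _ => rfl) fun q => ⟨⟨HahnSeries.single q 1, single_mem_puiseux q⟩, rfl⟩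

theorem mainTheorem4 (k : Type u) [Field k] [Infinite k] :
    (∀ (Γ : Type v) [AddCommGroup Γ] [LinearOrder Γ] [IsOrderedAddMonoid Γ], IsRankOne Γ →
      (hahnRes k Γ).Interprets arithLanguage ℕ ∧ (hahnRes k Γ).Undecidable) ∧
    ((puiseuxRes k).Interprets arithLanguage ℕ ∧ (puiseuxRes k).Undecidable) := by
  refine ⟨fun Γ _ _ _ hΓ => ?_, ?_⟩
  · have h := isTotalResidue_hahnRes k hΓ
    have hA := h.polyClosed.arithClosed
    exact ⟨h.interprets hA, h.undecidable hA⟩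
  · have h := isTotalResidue_puiseuxRes k
    have hA := h.polyClosed.arithClosed
    exact ⟨h.interprets hA, h.undecidable hA⟩
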